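/- Let $K$ be an arbitrary field, $n\ge 1$, $x=(x_1,\dots,x_n)$ and $y=(y_1,\dots,y_n)$ tuples of variables, and $t$ a further indeterminate. For a tuple $G=(G_1,\dots,G_m)$ of elements of $K(x)$, let $\mathcal JG=(\partial G_i/\partial x_j)_{i,j}$ denote its Jacobian matrix with respect to $x$. Let $H\in K(x)^n$ with $$\operatorname{trdeg}_K K(tH_1,\dots,tH_n)\le 2 .$$ Let $\tilde H$ be the primitive part of $H$: if $H\ne0$, this is the tuple $\tilde H\in K[x]^n$ (unique up to a factor in $K^*$) that is a $K(x)$-multiple of $H$ and satisfies $\gcd\{\tilde H_1,\dots,\tilde H_n\}=1$; if $H=0$, put $\tilde H=0$. Then the following statements are equivalent: (1) $\mathcal JH\cdot H=\operatorname{tr}\mathcal JH\cdot H$; (2) $\mathcal J\tilde H\cdot\tilde H(y)=\operatorname{tr}\mathcal J\tilde H\cdot\tilde H(y)=0$ in $K[x,y]^n$; (3) there exist $h\in K[y_1,y_2]^n$ that is zero or has all components homogeneous of the same degree (zero components allowed), such that $\deg h>0$ implies that $\operatorname{char}K$ does not divide $\deg h$ (a condition that always holds if $\operatorname{char}K=0$),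 polynomials $p,q\in K[x]$ with $\gcd\{p,q\}=1$, and $g\in K(x)$, such that $H=g\cdot h(p,q)$ and $\mathcal J(h(p,q))\cdot h(p,q)=0$; (4) there exist $f\in K[y_1]^n$, $p,q\in K[x]$ with $q\neq0$, and $g\in K(x)$, such that $H=g\cdot f(p/q)$ and $\mathcal Jp\cdot f=\mathcal Jq\cdot f=0$ in $K[x][y_1]$; (5) there exist $f,p,q,g$ as in (4) such that in addition $\gcd\{f_1,\dots,f_n\}=1$ and $\gcd\{p,q\}=1$. Furthermore, if any of (1)–(5) is satisfied, then, with $r=n-\operatorname{rk}\mathcal J\tilde H$ (rank over $K(x)$), there are vectors $v_1,\dots,v_r\in K^n$ such that $\tilde H$ is a $K[x]$-linear combination of $v_1,\dots,v_r$, hence $H$ is a $K(x)$-linear combination of $v_1,\dots,v_r$; and if $H\in K[x]^n$, then $H$ is a $K[x]$-linear combination of $v_1,\dots,v_r$. -/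

import Mathlib

noncomputable section

/-- The field `K(x)` of rational functions in `x_1, …, x_n`. -/
abbrev RatField (K : Type*) [Field K] (n : ℕ) : Type _ :=
  FractionRing (MvPolynomial (Fin n) K)

/-- The embedding `K[x] → K(x)`. -/
abbrev toRat {K : Type*} [Field K] {n : ℕ} (a : MvPolynomial (Fin n) K) : RatField K n :=
  algebraMap (MvPolynomial (Fin n) K) (RatField K n) a

/-- The partial derivative `∂r/∂x_i` of a rational function `r`, by the quotient rule applied
to the reduced fraction of `r`; `ratPderiv_div` shows that any fraction gives the same value. -/
def ratPderiv {K : Type*} [Field K] {n : ℕ} (i : Fin n) (r : RatField K n) : RatField K n :=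
  let a : MvPolynomial (Fin n) K := IsFractionRing.num (MvPolynomial (Fin n) K) r
  let b : MvPolynomial (Fin n) K := ↑(IsFractionRing.den (MvPolynomial (Fin n) K) r)
  toRat (MvPolynomial.pderiv i a * b - a * MvPolynomial.pderiv i b) / toRat b ^ 2

theorem ratPderiv_div {K : Type*} [Field K] {n : ℕ} (i : Fin n)
    (a b : MvPolynomial (Fin n) K) (hb : b ≠ 0) :
    ratPderiv i (toRat a / toRat b) =
      toRat (MvPolynomial.pderiv i a * b - a * MvPolynomial.pderiv i b) / toRat b ^ 2 := by
  set r : RatField K n := toRat a / toRat b with hr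
  unfold ratPderiv
  set c : MvPolynomial (Fin n) K := IsFractionRing.num (MvPolynomial (Fin n) K) r with hc
  set d : MvPolynomial (Fin n) K := ↑(IsFractionRing.den (MvPolynomial (Fin n) K) r) with hd
  have hd0 : d ≠ 0 := nonZeroDivisors.coe_ne_zero _
  have inj := IsFractionRing.injective (MvPolynomial (Fin n) K) (RatField K n)
  have hb' : toRat b ≠ 0 := fun h => hb (inj (by simpa using h))
  have hd' : toRat d ≠ 0 := fun h => hd0 (inj (by simpa using h))
  have hcd : toRat c / toRat d = r :=
    IsFractionRing.mk'_num_den' (A := MvPolynomial (Fin n) K) r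
  have e : a * d = c * b := by
    apply inj
    rw [hr, div_eq_div_iff hd' hb'] at hcd
    simpa [toRat, map_mul] using hcd.symm
  have e' := congrArg (MvPolynomial.pderiv i) e
  simp only [Derivation.leibniz, smul_eq_mul] at e'
  rw [div_eq_div_iff (pow_ne_zero _ hd') (pow_ne_zero _ hb')]
  simp only [toRat, ← map_pow, ← map_mul]
  congr 1
  linear_combination (-b * d) * e' + (MvPolynomial.pderiv i b * d + MvPolynomial.pderiv i d * b) * e

/-- The Jacobian matrix (with respect to `x`) of a tuple of rational functions. -/
def ratJacobian {K : Type*} [Field K] {n m : ℕ} (H : Fin m → RatField K n) :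
    Matrix (Fin m) (Fin n) (RatField K n) :=
  Matrix.of fun k i => ratPderiv i (H k)

/-- The Jacobian matrix (with respect to `x`) of a tuple of polynomials. -/
def polyJacobian {K : Type*} [Field K] {n m : ℕ} (P : Fin m → MvPolynomial (Fin n) K) :
    Matrix (Fin m) (Fin n) (MvPolynomial (Fin n) K) :=
  Matrix.of fun k i => MvPolynomial.pderiv i (P k)

/-- A tuple is primitive if its greatest common divisor is `1`, that is, if every common divisor
of its components is a unit. -/
def IsPrimitiveTuple {R : Type*} [CommRing R] {m : ℕ} (v : Fin m → R) : Prop :=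
  ∀ d : R, (∀ i, d ∣ v i) → IsUnit d

/-- `P` is a primitive part of `H`: a primitive tuple over `K[x]` that is a `K(x)`-multiple of
`H`. The primitive part of `0` is `0`. -/
def IsPrimitivePart {K : Type*} [Field K] {n m : ℕ} (H : Fin m → RatField K n)
    (P : Fin m → MvPolynomial (Fin n) K) : Prop :=
  (H = 0 ∧ P = 0) ∨
    (H ≠ 0 ∧ IsPrimitiveTuple P ∧ ∃ c : RatField K n, ∀ k, toRat (P k) = c * H k)

/-- The transcendence degree of `K(tH) = K(tH_1, …, tH_m)` over `K`, inside `K(x)(t)`. -/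
def trdegScaled {K : Type*} [Field K] {n m : ℕ} (H : Fin m → RatField K n) : Cardinal :=
  Algebra.trdeg K (IntermediateField.adjoin K
    (Set.range fun k : Fin m =>
      (RatFunc.X * algebraMap (RatField K n) (RatFunc (RatField K n)) (H k) :
        RatFunc (RatField K n))))

/-- `JH · H = tr JH · H`. -/
def JacobianTraceEq {K : Type*} [Field K] {n : ℕ} (H : Fin n → RatField K n) : Prop :=
  (ratJacobian H).mulVec H = (ratJacobian H).trace • H

/-- `JP · P(y) = tr JP · P(y) = 0` in `K[x, y]`; the variables `x` are indexed by the left summand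
of `Fin n ⊕ Fin n` and the variables `y` by the right one. -/
def JacobianSeparatedZero {K : Type*} [Field K] {n : ℕ}
    (P : Fin n → MvPolynomial (Fin n) K) : Prop :=
  let Jx : Matrix (Fin n) (Fin n) (MvPolynomial (Fin n ⊕ Fin n) K) :=
    (polyJacobian P).map (MvPolynomial.rename Sum.inl)
  let Py : Fin n → MvPolynomial (Fin n ⊕ Fin n) K := fun k => MvPolynomial.rename Sum.inr (P k)
  Jx.mulVec Py = 0 ∧ Jx.trace • Py = 0

/-- `H = g · h(p, q)` with `h ∈ K[y_1, y_2]^n` homogeneous (or zero), of degree not divisible by the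
characteristic of `K` if that degree is positive, `gcd(p, q) = 1` and `J(h(p,q)) · h(p,q) = 0`. -/
def HomogeneousForm {K : Type*} [Field K] {n : ℕ} (H : Fin n → RatField K n) : Prop :=
  ∃ (h : Fin n → MvPolynomial (Fin 2) K) (s : ℕ) (p q : MvPolynomial (Fin n) K) (g : RatField K n),
    (∀ k, (h k).IsHomogeneous s) ∧ (0 < s → ¬ ringChar K ∣ s) ∧ IsRelPrime p q ∧
    (∀ k, H k = g * toRat (MvPolynomial.aeval ![p, q] (h k))) ∧
    (polyJacobian fun k => MvPolynomial.aeval ![p, q] (h k)).mulVec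
      (fun k => MvPolynomial.aeval ![p, q] (h k)) = 0

/-- `H = g · f(p/q)` for some `g ∈ K(x)`, with `Jp · f = Jq · f = 0` in `K[x][y_1]`. -/
def IsFractionForm {K : Type*} [Field K] {n : ℕ} (H : Fin n → RatField K n)
    (f : Fin n → Polynomial K) (p q : MvPolynomial (Fin n) K) : Prop :=
  q ≠ 0 ∧
  (∃ g : RatField K n, ∀ k, H k = g * Polynomial.aeval (toRat p / toRat q) (f k)) ∧
  ∑ i, Polynomial.C (MvPolynomial.pderiv i p) * (f i).map MvPolynomial.C = 0 ∧
  ∑ i, Polynomial.C (MvPolynomial.pderiv i q) * (f i).map MvPolynomial.C = 0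

/-- `P` is an `R`-linear combination of the vectors `v j` over `K`. -/
def IsCombination {K : Type*} [Field K] {n r : ℕ} {R : Type*} [CommRing R] [Algebra K R]
    (P : Fin n → R) (v : Fin r → Fin n → K) : Prop :=
  ∃ a : Fin r → R, ∀ k, P k = ∑ j, a j * algebraMap K R (v j k)

end

open Polynomial (derivative)
open MvPolynomial (pderiv)

noncomputable section

/-! ### Partial and directional derivatives on `K(x)`, and the trace condition. -/

section RationalDerivation

variable {K : Type*} [Field K] {n : ℕ}

/-! Condition (5) is the hub: (1) implies (5), and (5) implies each of (2), (3), (4), which each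
lead back to (1).

For (1) ⇒ (5), the bound on the transcendence degree makes the ratios of components of `H` generate
a field of transcendence degree at most one. By Lüroth's theorem (`exists_adjoin_eq_adjoin_simple`)
this gives `H = g · f(θ)` with `θ = p/q` reduced and `f` primitive (`exists_parametrization`). The
trace condition ignores the factor `g` and reads `(∇θ · f(θ)) f'(θ) = (∇θ · f'(θ)) f(θ)`. If `f' ≠
0`, then `f(θ)` and `f'(θ)` are independent, so both scalars vanish. Hence `N(y) = q (∇p · f(y)) - p
(∇q · f(y))` has a double root at `θ` and is divisible by `(q y - p)²`. But `N` has `x`-degree below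
`deg p + deg q`, so `N = 0`; coprimality and degree then force `∇p · f = ∇q · f = 0`
(`gradDot_eq_zero_of_double_root`). If `f' = 0`, either `f` is constant or `p`, `q` can be replaced
by their `char K`-th powers.

For (5) ⇒ (2), the constant vector fields given by the coefficients of `f` kill `p` and `q`, hence
`q^s f(p/q) = d · P`; by primitivity of `P` and degree they kill `d` and `P` separately.
Homogenizing `f` gives (3); conversely (3) either makes `f(θ)` and `f'(θ)` proportional, whence (1)
at once, or yields `∇p · f = ∇q · f = 0` by the same degree argument with a simple root.

The final claim follows from (2): comparing coefficients in `y`, the coefficient vectors of `P` lie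
in the kernel of `JP`, so they span at most `n - rk JP` dimensions over `K`. -/

theorem toRat_injective : Function.Injective (toRat (K := K) (n := n)) :=
  IsFractionRing.injective (MvPolynomial (Fin n) K) (RatField K n)

theorem toRat_ne_zero {a : MvPolynomial (Fin n) K} (ha : a ≠ 0) : toRat a ≠ 0 :=
  (map_ne_zero_iff _ toRat_injective).2 ha

theorem exists_eq_toRat_div (r : RatField K n) :
    ∃ a b : MvPolynomial (Fin n) K, b ≠ 0 ∧ r = toRat a / toRat b := by
  obtain ⟨a, b, hb, h⟩ := IsFractionRing.div_surjective (A := MvPolynomial (Fin n) K) r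
  exact ⟨a, b, nonZeroDivisors.ne_zero hb, h.symm⟩

theorem ratPderiv_toRat (i : Fin n) (a : MvPolynomial (Fin n) K) :
    ratPderiv i (toRat a) = toRat (pderiv i a) := by
  simpa using ratPderiv_div i a 1 one_ne_zero

theorem ratPderiv_add (i : Fin n) (r s : RatField K n) :
    ratPderiv i (r + s) = ratPderiv i r + ratPderiv i s := by
  obtain ⟨a, b, hb, rfl⟩ := exists_eq_toRat_div r
  obtain ⟨c, d, hd, rfl⟩ := exists_eq_toRat_div s
  have hb' := toRat_ne_zero hb
  have hd' := toRat_ne_zero hd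
  have e : toRat a / toRat b + toRat c / toRat d = toRat (a * d + b * c) / toRat (b * d) := by
    rw [div_add_div _ _ hb' hd']; simp only [map_add, map_mul]
  rw [e, ratPderiv_div _ _ _ (mul_ne_zero hb hd), ratPderiv_div _ _ _ hb, ratPderiv_div _ _ _ hd]
  simp only [Derivation.leibniz, map_add, map_mul, map_sub, smul_eq_mul]
  field_simp
  ring

theorem ratPderiv_mul (i : Fin n) (r s : RatField K n) :
    ratPderiv i (r * s) = r * ratPderiv i s + s * ratPderiv i r := by
  obtain ⟨a, b, hb, rfl⟩ := exists_eq_toRat_div r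
  obtain ⟨c, d, hd, rfl⟩ := exists_eq_toRat_div s
  have hb' := toRat_ne_zero hb
  have hd' := toRat_ne_zero hd
  have e : toRat a / toRat b * (toRat c / toRat d) = toRat (a * c) / toRat (b * d) := by
    rw [div_mul_div_comm]; simp only [map_mul]
  rw [e, ratPderiv_div _ _ _ (mul_ne_zero hb hd), ratPderiv_div _ _ _ hb, ratPderiv_div _ _ _ hd]
  simp only [Derivation.leibniz, map_add, map_mul, map_sub, smul_eq_mul]
  field_simp
  ring

theorem ratPderiv_algebraMap (i : Fin n) (c : K) :
    ratPderiv i (algebraMap K (RatField K n) c) = 0 := by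
  rw [IsScalarTower.algebraMap_apply K (MvPolynomial (Fin n) K) (RatField K n)]
  refine (ratPderiv_toRat i _).trans ?_
  simp [MvPolynomial.algebraMap_eq]

/-- The partial derivative of rational functions as a derivation of `K(x)`. -/
def ratDerivation (i : Fin n) : Derivation K (RatField K n) (RatField K n) :=
  Derivation.mk'
    { toFun := ratPderiv i
      map_add' := ratPderiv_add i
      map_smul' := fun c r => by
        simp [Algebra.smul_def, ratPderiv_mul, ratPderiv_algebraMap] }
    (ratPderiv_mul i)

theorem ratPderiv_aeval (i : Fin n) (f : Polynomial K) (r : RatField K n) :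
    ratPderiv i (Polynomial.aeval r f) =
      Polynomial.aeval r (derivative f) * ratPderiv i r :=
  (ratDerivation i).map_aeval f r

/-- The derivative of `u` in the direction of the vector field `w`. -/
def dirDeriv (w : Fin n → RatField K n) (u : RatField K n) : RatField K n :=
  ∑ i, ratPderiv i u * w i

theorem dirDeriv_mul (w : Fin n → RatField K n) (u v : RatField K n) :
    dirDeriv w (u * v) = u * dirDeriv w v + v * dirDeriv w u := by
  simp only [dirDeriv, Finset.mul_sum, ← Finset.sum_add_distrib, ratPderiv_mul]
  exact Finset.sum_congr rfl fun i _ => by ring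

theorem dirDeriv_smul (w : Fin n → RatField K n) (g u : RatField K n) :
    dirDeriv (g • w) u = g * dirDeriv w u := by
  simp only [dirDeriv, Finset.mul_sum, Pi.smul_apply, smul_eq_mul]
  exact Finset.sum_congr rfl fun i _ => by ring

theorem dirDeriv_aeval (w : Fin n → RatField K n) (f : Polynomial K) (r : RatField K n) :
    dirDeriv w (Polynomial.aeval r f) = Polynomial.aeval r (derivative f) * dirDeriv w r := by
  simp only [dirDeriv, Finset.mul_sum, ratPderiv_aeval, mul_assoc]

theorem jacobianTraceEq_iff (H : Fin n → RatField K n) :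
    JacobianTraceEq H ↔ ∀ k, dirDeriv H (H k) = (∑ i, ratPderiv i (H i)) * H k := by
  simp only [JacobianTraceEq, funext_iff]
  rfl

/-- Differentiating `g` contributes the same term, `g` times the derivative of `g` along `R` times
`R`, to both sides. This is why the trace appears in (1), and it reduces everything to a convenient
multiple of `H`. -/
theorem jacobianTraceEq_smul_iff {g : RatField K n} (hg : g ≠ 0) (R : Fin n → RatField K n) :
    JacobianTraceEq (g • R) ↔ JacobianTraceEq R := by
  have htr : ∑ i, ratPderiv i ((g • R) i) = g * ∑ i, ratPderiv i (R i) + dirDeriv R g := by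
    simp only [Pi.smul_apply, smul_eq_mul, ratPderiv_mul, Finset.sum_add_distrib, Finset.mul_sum,
      dirDeriv]
    exact congrArg _ (Finset.sum_congr rfl fun i _ => by ring)
  simp only [jacobianTraceEq_iff, htr]
  refine forall_congr' fun k => ?_
  rw [dirDeriv_smul, Pi.smul_apply, smul_eq_mul, dirDeriv_mul]
  constructor
  · intro h
    apply mul_left_cancel₀ (pow_ne_zero 2 hg)
    linear_combination h
  · intro h
    linear_combination g ^ 2 * h

theorem jacobianTraceEq_zero : JacobianTraceEq (0 : Fin n → RatField K n) := by
  simp [JacobianTraceEq]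

/-- With `φ = f(θ)` and `ψ` the derivative of `f` at `θ`, the trace condition for `φ` reads
`(∇θ · φ) ψ = (∇θ · ψ) φ`. -/
theorem jacobianTraceEq_aeval_iff (f : Fin n → Polynomial K) (θ : RatField K n) :
    JacobianTraceEq (fun k => Polynomial.aeval θ (f k)) ↔
      ∀ k, Polynomial.aeval θ (derivative (f k)) *
          dirDeriv (fun i => Polynomial.aeval θ (f i)) θ =
        dirDeriv (fun i => Polynomial.aeval θ (derivative (f i))) θ *
          Polynomial.aeval θ (f k) := by
  rw [jacobianTraceEq_iff]
  refine forall_congr' fun k => ?_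
  simp only [dirDeriv_aeval, ratPderiv_aeval]
  simp only [dirDeriv, mul_comm]

theorem dirDeriv_toRat_div (w : Fin n → RatField K n) (p : MvPolynomial (Fin n) K)
    {q : MvPolynomial (Fin n) K} (hq : q ≠ 0) :
    dirDeriv w (toRat p / toRat q) * toRat q ^ 2 =
      toRat q * dirDeriv w (toRat p) - toRat p * dirDeriv w (toRat q) := by
  have hq' := toRat_ne_zero hq
  simp only [dirDeriv, Finset.mul_sum, Finset.sum_mul, ← Finset.sum_sub_distrib,
    ratPderiv_div _ _ _ hq, ratPderiv_toRat]
  refine Finset.sum_congr rfl fun i _ => ?_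
  simp only [map_sub, map_mul]
  field_simp

/-- The polynomial `∑ i, ∂p/∂x_i · f_i(y)` in `K[x][y]`. -/
def gradDot (p : MvPolynomial (Fin n) K) (f : Fin n → Polynomial K) :
    Polynomial (MvPolynomial (Fin n) K) :=
  ∑ i, Polynomial.C (pderiv i p) * (f i).map MvPolynomial.C

theorem aeval_gradDot (p : MvPolynomial (Fin n) K) (f : Fin n → Polynomial K)
    (θ : RatField K n) :
    Polynomial.aeval θ (gradDot p f) =
      dirDeriv (fun i => Polynomial.aeval θ (f i)) (toRat p) := by
  simp only [gradDot, dirDeriv, map_sum, map_mul, Polynomial.aeval_C, ratPderiv_toRat]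
  refine Finset.sum_congr rfl fun i _ => ?_
  rw [← MvPolynomial.algebraMap_eq, Polynomial.aeval_map_algebraMap]

theorem derivative_gradDot (p : MvPolynomial (Fin n) K) (f : Fin n → Polynomial K) :
    derivative (gradDot p f) = gradDot p fun i => derivative (f i) := by
  simp [gradDot, Polynomial.derivative_map]

theorem coeff_gradDot (p : MvPolynomial (Fin n) K) (f : Fin n → Polynomial K) (j : ℕ) :
    (gradDot p f).coeff j = ∑ i, pderiv i p * MvPolynomial.C ((f i).coeff j) := by
  simp [gradDot]

/-- The identities `∇p · f = ∇q · f = 0` hold in `K[x][y]`, so they survive differentiation in `y`;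
both sides of the reformulated trace condition then vanish. Coprimality of `p` and `q` plays no
role. -/
theorem IsFractionForm.jacobianTraceEq {H : Fin n → RatField K n} {f : Fin n → Polynomial K}
    {p q : MvPolynomial (Fin n) K} (h : IsFractionForm H f p q) : JacobianTraceEq H := by
  obtain ⟨hq, ⟨g, hg⟩, hp0, hq0⟩ := h
  change gradDot p f = 0 at hp0
  change gradDot q f = 0 at hq0
  set θ : RatField K n := toRat p / toRat q with hθ
  obtain rfl : H = g • fun k => Polynomial.aeval θ (f k) := funext hg
  obtain rfl | hg0 := eq_or_ne g 0
  · rw [zero_smul]; exact jacobianTraceEq_zero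
  have key : ∀ e : Fin n → Polynomial K, gradDot p e = 0 → gradDot q e = 0 →
      dirDeriv (fun i => Polynomial.aeval θ (e i)) θ = 0 := by
    intro e h1 h2
    have := dirDeriv_toRat_div (fun i => Polynomial.aeval θ (e i)) p hq
    rw [← aeval_gradDot, ← aeval_gradDot, h1, h2, map_zero, mul_zero, mul_zero, sub_zero] at this
    exact (mul_eq_zero.1 this).resolve_right (pow_ne_zero _ (toRat_ne_zero hq))
  rw [jacobianTraceEq_smul_iff hg0, jacobianTraceEq_aeval_iff]
  intro k
  rw [key f hp0 hq0, key (fun i => derivative (f i)) (by rw [← derivative_gradDot, hp0, map_zero])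
    (by rw [← derivative_gradDot, hq0, map_zero])]
  simp

/-- Two vectors over a field are either linearly independent, as witnessed by a minor, or
proportional. -/
theorem eq_zero_of_smul_add_smul_eq_zero {ι F : Type*} [Field F] {u v : ι → F} {k l : ι}
    (h : u k * v l - v k * u l ≠ 0) {a b : F} (hab : ∀ i, a * u i + b * v i = 0) :
    a = 0 ∧ b = 0 := by
  constructor
  · apply (mul_eq_zero.1 (?_ : a * (u k * v l - v k * u l) = 0)).resolve_right h
    linear_combination v l * hab k - v k * hab l
  · apply (mul_eq_zero.1 (?_ : b * (u k * v l - v k * u l) = 0)).resolve_right h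
    linear_combination u k * hab l - u l * hab k

theorem exists_eq_smul_of_minors_eq_zero {ι F : Type*} [Field F] {u v : ι → F}
    (h : ∀ k l, u k * v l - v k * u l = 0) (hu : u ≠ 0) : ∃ c : F, v = c • u := by
  obtain ⟨k, hk⟩ := Function.ne_iff.1 hu
  refine ⟨v k / u k, funext fun l => ?_⟩
  have hk' : u k ≠ 0 := hk
  simp only [Pi.smul_apply, smul_eq_mul]
  field_simp
  linear_combination h k l

end RationalDerivation

/-! ### Degree in `x` against multiplicity of the root `p/q`. -/

section Degree

variable {K : Type*} [Field K] {n : ℕ}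

theorem totalDegree_pderiv_lt {p : MvPolynomial (Fin n) K} {i : Fin n} (h : pderiv i p ≠ 0) :
    (pderiv i p).totalDegree < p.totalDegree := by
  classical
  have hp : 0 < p.totalDegree := by
    rw [Nat.pos_iff_ne_zero]
    intro h0
    rw [MvPolynomial.totalDegree_eq_zero_iff_eq_C.1 h0, MvPolynomial.pderiv_C] at h
    exact h rfl
  rw [MvPolynomial.totalDegree, Finset.sup_lt_iff (by simpa using hp)]
  intro m hm
  have hm' : m + Finsupp.single i 1 ∈ p.support := by
    rw [MvPolynomial.mem_support_iff] at hm ⊢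
    intro h0
    apply hm
    rw [MvPolynomial.coeff_pderiv, h0, zero_mul]
  have := MvPolynomial.le_totalDegree hm'
  rw [Finsupp.sum_add_index' (by simp) (by simp), Finsupp.sum_single_index rfl] at this
  omega

theorem totalDegree_sum_pderiv_mul_C_lt {p : MvPolynomial (Fin n) K} {c : Fin n → K}
    (h : ∑ i, pderiv i p * MvPolynomial.C (c i) ≠ 0) :
    (∑ i, pderiv i p * MvPolynomial.C (c i)).totalDegree < p.totalDegree := by
  obtain ⟨i, -, hi⟩ := Finset.exists_ne_zero_of_sum_ne_zero h
  have hi' := totalDegree_pderiv_lt (left_ne_zero_of_mul hi)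
  refine lt_of_le_of_lt (MvPolynomial.totalDegree_finsetSum_le
    (d := p.totalDegree - 1) fun j _ => ?_) (by omega)
  by_cases hj : pderiv j p = 0
  · simp [hj]
  · have := totalDegree_pderiv_lt hj
    refine (MvPolynomial.totalDegree_mul _ _).trans ?_
    rw [MvPolynomial.totalDegree_C]
    omega

/-- A polynomial dividing a `K`-combination of its partial derivatives annihilates it. -/
theorem sum_pderiv_mul_C_eq_zero_of_dvd {p : MvPolynomial (Fin n) K} {c : Fin n → K}
    (h : p ∣ ∑ i, pderiv i p * MvPolynomial.C (c i)) :
    ∑ i, pderiv i p * MvPolynomial.C (c i) = 0 := by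
  by_contra h0
  exact absurd (MvPolynomial.totalDegree_le_of_dvd_of_isDomain h h0)
    (not_le.2 (totalDegree_sum_pderiv_mul_C_lt h0))

/-- The exchange of the roles of the variables, `K[x][y] → K[y][x]`. -/
def swapVars (K : Type*) [Field K] (n : ℕ) :
    Polynomial (MvPolynomial (Fin n) K) →+* MvPolynomial (Fin n) (Polynomial K) :=
  Polynomial.eval₂RingHom (MvPolynomial.map Polynomial.C) (MvPolynomial.C Polynomial.X)

theorem coeff_swapVars (N : Polynomial (MvPolynomial (Fin n) K)) (m : Fin n →₀ ℕ) (j : ℕ) :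
    ((swapVars K n N).coeff m).coeff j = (N.coeff j).coeff m := by
  induction N using Polynomial.induction_on' with
  | add a b ha hb => simp [ha, hb]
  | monomial k a =>
    simp only [swapVars, Polynomial.coe_eval₂RingHom, Polynomial.eval₂_monomial, ← map_pow]
    rw [mul_comm, MvPolynomial.coeff_C_mul, mul_comm, MvPolynomial.coeff_map,
      Polynomial.coeff_C_mul, Polynomial.coeff_X_pow, Polynomial.coeff_monomial]
    by_cases h : j = k <;> simp [h, eq_comm]

theorem swapVars_injective : Function.Injective (swapVars K n) := by
  rw [injective_iff_map_eq_zero]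
  intro N hN
  ext j m
  rw [← coeff_swapVars, hN]
  simp

theorem le_totalDegree_swapVars (N : Polynomial (MvPolynomial (Fin n) K)) (j : ℕ) :
    (N.coeff j).totalDegree ≤ (swapVars K n N).totalDegree := by
  refine Finset.sup_le fun m hm => MvPolynomial.le_totalDegree ?_
  rw [MvPolynomial.mem_support_iff] at hm ⊢
  intro h0
  apply hm
  rw [← coeff_swapVars, h0, Polynomial.coeff_zero]

theorem totalDegree_swapVars_le {N : Polynomial (MvPolynomial (Fin n) K)} {d : ℕ}
    (h : ∀ j, (N.coeff j).totalDegree ≤ d) : (swapVars K n N).totalDegree ≤ d := by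
  refine Finset.sup_le fun m hm => ?_
  rw [MvPolynomial.mem_support_iff] at hm
  obtain ⟨j, hj⟩ : ∃ j, ((swapVars K n N).coeff m).coeff j ≠ 0 := by
    by_contra! h0
    exact hm (Polynomial.ext (by simpa using h0))
  rw [coeff_swapVars] at hj
  exact (MvPolynomial.le_totalDegree (MvPolynomial.mem_support_iff.2 hj)).trans (h j)

/-- Viewed in `K[y][x]`, total degree in `x` is additive on products, and `q y - p` has degree at
least `max (deg p) (deg q)`. A nonzero multiple of its `e`-th power therefore has some coefficient
of degree at least `e` times that. -/
theorem eq_zero_of_pow_dvd_of_totalDegree_lt {p q : MvPolynomial (Fin n) K} {e : ℕ}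
    {N : Polynomial (MvPolynomial (Fin n) K)}
    (hdvd : (Polynomial.C q * Polynomial.X - Polynomial.C p) ^ e ∣ N)
    (hlt : ∀ j, N.coeff j ≠ 0 → (N.coeff j).totalDegree < e * max p.totalDegree q.totalDegree) :
    N = 0 := by
  by_contra hN
  obtain ⟨M, rfl⟩ := hdvd
  set l : Polynomial (MvPolynomial (Fin n) K) :=
    Polynomial.C q * Polynomial.X - Polynomial.C p with hl
  have hl0 : l ^ e ≠ 0 := left_ne_zero_of_mul hN
  have hM0 : M ≠ 0 := right_ne_zero_of_mul hN
  have inj := swapVars_injective (K := K) (n := n)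
  have h1 : max p.totalDegree q.totalDegree ≤ (swapVars K n l).totalDegree := by
    have h0 := le_totalDegree_swapVars l 0
    have h1 := le_totalDegree_swapVars l 1
    simp only [hl, Polynomial.coeff_sub, Polynomial.coeff_C_mul, Polynomial.coeff_X_zero,
      Polynomial.coeff_X_one, Polynomial.coeff_C_zero, Polynomial.coeff_C_succ, mul_zero,
      zero_sub, mul_one, sub_zero, MvPolynomial.totalDegree_neg] at h0 h1
    exact max_le h0 h1
  have h2 : (swapVars K n (l ^ e * M)).totalDegree =
      e * (swapVars K n l).totalDegree + (swapVars K n M).totalDegree := by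
    rw [map_mul, MvPolynomial.totalDegree_mul_of_isDomain
      ((map_ne_zero_iff _ inj).2 hl0) ((map_ne_zero_iff _ inj).2 hM0), map_pow]
    congr 1
    have hl1 : swapVars K n l ≠ 0 ∨ e = 0 := by
      refine or_iff_not_imp_right.2 fun he h0 => hl0 ?_
      rw [(map_eq_zero_iff _ inj).1 h0, zero_pow he]
    rcases hl1 with hl1 | rfl
    · clear hlt hN hl0
      induction e with
      | zero => simp
      | succ e ih =>
        rw [pow_succ, MvPolynomial.totalDegree_mul_of_isDomain (pow_ne_zero _ hl1) hl1, ih]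
        ring
    · simp
  -- A nonzero coefficient shows that the degree bound is positive, so the truncated subtraction of
  -- `1` in `h3` is a true one.
  obtain ⟨j, hj⟩ : ∃ j, (l ^ e * M).coeff j ≠ 0 := by
    by_contra! h0
    exact hN (Polynomial.ext (by simpa using h0))
  have hpos := hlt j hj
  have h3 : (swapVars K n (l ^ e * M)).totalDegree ≤ e * max p.totalDegree q.totalDegree - 1 := by
    refine totalDegree_swapVars_le fun j => ?_
    by_cases hj : (l ^ e * M).coeff j = 0
    · simp [hj]
    · have := hlt j hj
      omega
  have := Nat.mul_le_mul_left e h1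
  omega

/-- A root `p / q` in lowest terms of a polynomial over `K[x]` splits off the factor `q y - p`. -/
theorem dvd_of_aeval_div_eq_zero {p q : MvPolynomial (Fin n) K} (hpq : IsRelPrime p q)
    (hq : q ≠ 0) {N : Polynomial (MvPolynomial (Fin n) K)}
    (hN : Polynomial.aeval (toRat p / toRat q) N = 0) :
    Polynomial.C q * Polynomial.X - Polynomial.C p ∣ N := by
  have hq' := toRat_ne_zero hq
  set θ : RatField K n := toRat p / toRat q with hθ
  -- This links `q` to the canonical denominator, so that the rational root theorem makes `q` divide
  -- the leading coefficient of `N`.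
  have hden : q ∣ (IsFractionRing.den (MvPolynomial (Fin n) K) θ : MvPolynomial (Fin n) K) := by
    have h1 := IsFractionRing.mk'_num_den' (A := MvPolynomial (Fin n) K) θ
    have hd : toRat (IsFractionRing.den (MvPolynomial (Fin n) K) θ : MvPolynomial (Fin n) K) ≠ 0 :=
      toRat_ne_zero (nonZeroDivisors.coe_ne_zero _)
    refine hpq.symm.dvd_of_dvd_mul_left
      ⟨IsFractionRing.num (MvPolynomial (Fin n) K) θ, toRat_injective ?_⟩
    rw [hθ, div_eq_div_iff hd hq'] at h1
    simp only [map_mul]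
    rw [mul_comm (toRat q)]
    exact h1.symm
  induction hd : N.natDegree using Nat.strong_induction_on generalizing N with
  | _ s ih =>
  by_cases hN0 : N = 0
  · simp [hN0]
  obtain ⟨m, hm⟩ := hden.trans (den_dvd_of_is_root hN)
  have hs : 0 < s := by
    rw [Nat.pos_iff_ne_zero]
    rintro rfl
    rw [Polynomial.eq_C_of_natDegree_eq_zero hd, Polynomial.aeval_C] at hN
    apply hN0
    rw [Polynomial.eq_C_of_natDegree_eq_zero hd, toRat_injective (hN.trans (map_zero _).symm),
      Polynomial.C_0]
  -- One step of division by `q y - p`: since the leading coefficient is `q m`, subtracting `T`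
  -- removes the top term and keeps the root.
  set T : Polynomial (MvPolynomial (Fin n) K) := Polynomial.C m * Polynomial.X ^ (s - 1) *
    (Polynomial.C q * Polynomial.X - Polynomial.C p) with hT
  have hTr : Polynomial.aeval θ T = 0 := by
    have : toRat q * θ - toRat p = 0 := by rw [hθ]; field_simp; simp
    simp only [hT, map_mul, map_sub, Polynomial.aeval_C, Polynomial.aeval_X]
    rw [this, mul_zero]
  have hTe : T = Polynomial.C (q * m) * Polynomial.X ^ s -
      Polynomial.C (m * p) * Polynomial.X ^ (s - 1) := by
    obtain ⟨t, rfl⟩ := Nat.exists_eq_succ_of_ne_zero hs.ne'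
    simp only [hT, Nat.succ_eq_add_one, Nat.add_sub_cancel, map_mul, pow_succ]
    ring
  have hlt : (N - T).natDegree < s := by
    refine Nat.lt_of_le_pred hs (Polynomial.natDegree_le_iff_coeff_eq_zero.2 fun j hj => ?_)
    replace hj : s ≤ j := Nat.le_of_pred_lt hj
    rw [hTe]
    simp only [Polynomial.coeff_sub, Polynomial.coeff_C_mul_X_pow]
    rcases hj.eq_or_lt with rfl | hj
    · have h1 : ¬ s = s - 1 := by omega
      rw [if_pos rfl, if_neg h1, ← hm, Polynomial.leadingCoeff, hd]
      ring
    · rw [if_neg (by omega), if_neg (by omega),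
        Polynomial.coeff_eq_zero_of_natDegree_lt (by omega)]
      ring
  have := ih _ hlt (N := N - T) (by rw [map_sub, hN, hTr, sub_zero]) rfl
  exact (dvd_sub_left (Dvd.intro_left _ rfl)).1 this

/-- Writing `N = (q y - p) M`, the derivative at the root is `q M(p/q)`, so `M` has the same root.
This works in every characteristic. -/
theorem sq_dvd_of_aeval_div_eq_zero {p q : MvPolynomial (Fin n) K} (hpq : IsRelPrime p q)
    (hq : q ≠ 0) {N : Polynomial (MvPolynomial (Fin n) K)}
    (hN : Polynomial.aeval (toRat p / toRat q) N = 0)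
    (hN' : Polynomial.aeval (toRat p / toRat q) (derivative N) = 0) :
    (Polynomial.C q * Polynomial.X - Polynomial.C p) ^ 2 ∣ N := by
  have hq' := toRat_ne_zero hq
  obtain ⟨M, rfl⟩ := dvd_of_aeval_div_eq_zero hpq hq hN
  have h0 : toRat q * (toRat p / toRat q) - toRat p = 0 := by field_simp; simp
  have hM : Polynomial.aeval (toRat p / toRat q) M = 0 := by
    simp only [Polynomial.derivative_mul, Polynomial.derivative_C, Polynomial.derivative_X,
      map_add, map_mul, map_sub, Polynomial.aeval_C, Polynomial.aeval_X,
      zero_mul, mul_one, zero_add, sub_zero] at hN'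
    rw [h0, zero_mul, add_zero] at hN'
    exact (mul_eq_zero.1 hN').resolve_left hq'
  rw [pow_two]
  exact mul_dvd_mul_left _ (dvd_of_aeval_div_eq_zero hpq hq hM)

theorem gradDot_eq_zero_of_aeval {p q u : MvPolynomial (Fin n) K} (hpq : IsRelPrime p q)
    (hq : q ≠ 0) (hu : u.totalDegree ≤ max p.totalDegree q.totalDegree)
    {f : Fin n → Polynomial K} (h : Polynomial.aeval (toRat p / toRat q) (gradDot u f) = 0) :
    gradDot u f = 0 := by
  refine eq_zero_of_pow_dvd_of_totalDegree_lt (p := p) (q := q) (e := 1)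
    (by rw [pow_one]; exact dvd_of_aeval_div_eq_zero hpq hq h) fun j hj => ?_
  rw [coeff_gradDot] at hj ⊢
  rw [one_mul]
  exact (totalDegree_sum_pderiv_mul_C_lt hj).trans_le hu

/-- If `∇(p/q) · f(y)` has the double root `y = p/q`, then both `∇p · f` and `∇q · f` vanish. -/
theorem gradDot_eq_zero_of_double_root {p q : MvPolynomial (Fin n) K} (hpq : IsRelPrime p q)
    (hq : q ≠ 0) {f : Fin n → Polynomial K}
    (h : dirDeriv (fun i => Polynomial.aeval (toRat p / toRat q) (f i))
      (toRat p / toRat q : RatField K n) = 0)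
    (h' : dirDeriv (fun i => Polynomial.aeval (toRat p / toRat q) (derivative (f i)))
      (toRat p / toRat q : RatField K n) = 0) :
    gradDot p f = 0 ∧ gradDot q f = 0 := by
  set N := Polynomial.C q * gradDot p f - Polynomial.C p * gradDot q f with hNdef
  have hroot : ∀ e : Fin n → Polynomial K,
      dirDeriv (fun i => Polynomial.aeval (toRat p / toRat q) (e i))
        (toRat p / toRat q : RatField K n) = 0 →
      Polynomial.aeval (toRat p / toRat q : RatField K n)
        (Polynomial.C q * gradDot p e - Polynomial.C p * gradDot q e) = 0 := by
    intro e he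
    have := dirDeriv_toRat_div (fun i => Polynomial.aeval (toRat p / toRat q) (e i)) p hq
    rw [he, zero_mul] at this
    simp only [map_sub, map_mul, aeval_gradDot, Polynomial.aeval_C]
    exact this.symm
  -- Each coefficient of `N` has degree below `deg p + deg q ≤ 2 max (deg p) (deg q)`, because a
  -- partial derivative lowers the degree.
  have hN : N = 0 := by
    refine eq_zero_of_pow_dvd_of_totalDegree_lt
      (sq_dvd_of_aeval_div_eq_zero hpq hq (hroot f h) ?_) fun j hj => ?_
    · rw [hNdef]
      simp only [Polynomial.derivative_sub, Polynomial.derivative_mul, Polynomial.derivative_C,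
        zero_mul, zero_add, derivative_gradDot]
      exact hroot _ h'
    · have hc : N.coeff j = q * (gradDot p f).coeff j - p * (gradDot q f).coeff j := by
        simp [hNdef]
      have e1 : ∀ u v : MvPolynomial (Fin n) K, u * (gradDot v f).coeff j = 0 ∨
          (u * (gradDot v f).coeff j).totalDegree < u.totalDegree + v.totalDegree := by
        intro u v
        by_cases h0 : (gradDot v f).coeff j = 0
        · left; rw [h0, mul_zero]
        · right
          rw [coeff_gradDot] at h0 ⊢
          have := totalDegree_sum_pderiv_mul_C_lt h0
          have h2 := MvPolynomial.totalDegree_mul u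
            (∑ i, pderiv i v * MvPolynomial.C ((f i).coeff j))
          omega
      rw [hc] at hj ⊢
      have e2 := MvPolynomial.totalDegree_sub (q * (gradDot p f).coeff j)
        (p * (gradDot q f).coeff j)
      have e3 := le_max_left p.totalDegree q.totalDegree
      have e4 := le_max_right p.totalDegree q.totalDegree
      rcases e1 q p with ha | ha <;> rcases e1 p q with hb | hb
      · simp [ha, hb] at hj
      · rw [ha, zero_sub, MvPolynomial.totalDegree_neg]
        omega
      · rw [hb, sub_zero]
        omega
      · refine e2.trans_lt (max_lt ?_ ?_) <;> omega
  have hcoeff : ∀ j, q * (gradDot p f).coeff j = p * (gradDot q f).coeff j := by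
    intro j
    have := congrArg (fun M => Polynomial.coeff M j) hN
    simpa [hNdef, sub_eq_zero] using this
  constructor
  · ext1 j
    rw [Polynomial.coeff_zero, coeff_gradDot]
    apply sum_pderiv_mul_C_eq_zero_of_dvd
    rw [← coeff_gradDot]
    exact hpq.dvd_of_dvd_mul_left ⟨_, hcoeff j⟩
  · ext1 j
    rw [Polynomial.coeff_zero, coeff_gradDot]
    apply sum_pderiv_mul_C_eq_zero_of_dvd
    rw [← coeff_gradDot]
    exact hpq.symm.dvd_of_dvd_mul_left ⟨_, (hcoeff j).symm⟩

end Degree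

/-! ### Lüroth's theorem in several variables, by embedding into `K(X)`. -/

section Embedding

/-- A homomorphism on a subring of a field `E` of transcendence degree one which preserves the
transcendence of one element extends to the generated field. -/
theorem nonempty_algHom_adjoin_of_transcendental {K E F B κ : Type*} [Field K] [Field E] [Field F]
    [CommRing B] [Algebra K E] [Algebra K F] [Algebra K B] (ι : B →ₐ[K] E)
    (hι : Function.Injective ι) (σ : B →ₐ[K] F) (ρ : κ → B) (k₀ : κ)
    (htr : Transcendental K (σ (ρ k₀)))
    (halg : ∀ z ∈ Algebra.adjoin K (Set.range (ι ∘ ρ)),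
      IsAlgebraic (Algebra.adjoin K {ι (ρ k₀)}) z) :
    Nonempty (IntermediateField.adjoin K (Set.range (ι ∘ ρ)) →ₐ[K] F) := by
  -- A nonzero `b` has a multiple that is a nonzero polynomial in `ρ k₀`. If `σ b = 0`, that
  -- polynomial would vanish at the transcendental element `σ (ρ k₀)`.
  have key : ∀ b ∈ Algebra.adjoin K (Set.range ρ), σ b = 0 → b = 0 := by
    intro b hb hb0
    by_contra hne
    have hιb : ι b ∈ Algebra.adjoin K (Set.range (ι ∘ ρ)) := by
      rw [Set.range_comp, ← AlgHom.map_adjoin]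
      exact ⟨b, hb, rfl⟩
    have hne' : ι b ≠ 0 := (map_ne_zero_iff _ hι).2 hne
    obtain ⟨z, hz, y, hy, hzy⟩ := (halg _ hιb).exists_nonzero_eq_adjoin_mul
      (mem_nonZeroDivisors_of_ne_zero hne')
    have hS : ∀ s : Algebra.adjoin K {ι (ρ k₀)}, ∃ u : Polynomial K,
        (s : E) = ι (Polynomial.aeval (ρ k₀) u) := by
      rintro ⟨s, hs⟩
      rw [Algebra.adjoin_singleton_eq_range_aeval] at hs
      obtain ⟨u, rfl⟩ := hs
      exact ⟨u, (Polynomial.aeval_algHom_apply ι _ _)⟩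
    have hz' : z ∈ ι.range := by
      clear hzy
      induction hz using Algebra.adjoin_induction with
      | mem x hx => rw [Set.mem_singleton_iff.1 hx]; exact ⟨b, rfl⟩
      | algebraMap s =>
        obtain ⟨u, hu⟩ := hS s
        exact ⟨_, hu.symm⟩
      | add x y _ _ hx hy => exact add_mem hx hy
      | mul x y _ _ hx hy => exact mul_mem hx hy
    obtain ⟨c, rfl⟩ := hz'
    obtain ⟨u, hu⟩ := hS y
    have h1 : b * c = Polynomial.aeval (ρ k₀) u := by
      apply hι
      rw [map_mul, ← hu]
      exact hzy
    have h2 := congrArg σ h1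
    rw [map_mul, hb0, zero_mul, ← Polynomial.aeval_algHom_apply] at h2
    have h3 : u = 0 := by
      by_contra h
      exact htr ⟨u, h, h2.symm⟩
    apply hy
    apply Subtype.ext
    rw [hu, h3, map_zero, map_zero]
    rfl
  have hmap : Algebra.adjoin K (Set.range (ι ∘ ρ)) = (Algebra.adjoin K (Set.range ρ)).map ι := by
    rw [Set.range_comp, AlgHom.map_adjoin]
  let e : Algebra.adjoin K (Set.range (ι ∘ ρ)) ≃ₐ[K] Algebra.adjoin K (Set.range ρ) :=
    (Subalgebra.equivOfEq _ _ hmap).trans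
      ((Algebra.adjoin K (Set.range ρ)).equivMapOfInjective ι hι).symm
  let τ : Algebra.adjoin K (Set.range (ι ∘ ρ)) →ₐ[K] F :=
    (σ.comp (Algebra.adjoin K (Set.range ρ)).val).comp e.toAlgHom
  have hτ : Function.Injective τ := by
    rw [injective_iff_map_eq_zero]
    intro z hz
    exact (map_eq_zero_iff e e.injective).1 (Subtype.ext (key _ (e z).2 hz))
  open scoped IntermediateField.algebraAdjoinAdjoin in
  exact ⟨IsFractionRing.liftAlgHom (A := Algebra.adjoin K (Set.range (ι ∘ ρ)))
    (K := IntermediateField.adjoin K (Set.range (ι ∘ ρ))) hτ⟩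

variable {K : Type*} [Field K] {n : ℕ}

/-- Kronecker's substitution `x_i ↦ X ^ (N ^ i)`. -/
def kroneckerSubst (K : Type*) [Field K] (n N : ℕ) :
    MvPolynomial (Fin n) K →ₐ[K] Polynomial K :=
  MvPolynomial.aeval fun i => Polynomial.X ^ (N ^ (i : ℕ))

theorem sum_mul_pow_injOn {N : ℕ} {m m' : Fin n → ℕ} (hm : ∀ i, m i < N) (hm' : ∀ i, m' i < N)
    (h : ∑ i, m i * N ^ (i : ℕ) = ∑ i, m' i * N ^ (i : ℕ)) : m = m' := by
  have : finFunctionFinEquiv (fun i => (⟨m i, hm i⟩ : Fin N)) =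
      finFunctionFinEquiv (fun i => (⟨m' i, hm' i⟩ : Fin N)) := by
    apply Fin.ext
    simpa [finFunctionFinEquiv_apply] using h
  funext i
  simpa using congrFun (finFunctionFinEquiv.injective this) i

/-- All exponents are digits in base `N`, so distinct monomials go to distinct powers of `X` and
nothing cancels. -/
theorem kroneckerSubst_ne_zero {N : ℕ} {F : MvPolynomial (Fin n) K} (hF : F ≠ 0)
    (hN : F.totalDegree < N) : kroneckerSubst K n N F ≠ 0 := by
  have hlt : ∀ m ∈ F.support, ∀ i, m i < N := fun m hm i =>
    ((MvPolynomial.le_degreeOf_of_mem_support i hm).trans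
      (MvPolynomial.degreeOf_le_totalDegree F i)).trans_lt hN
  obtain ⟨m₀, hm₀⟩ := MvPolynomial.support_nonempty.2 hF
  intro h0
  have hc := congrArg (fun f => Polynomial.coeff f (∑ i, m₀ i * N ^ (i : ℕ))) h0
  simp only [kroneckerSubst, MvPolynomial.aeval_def, MvPolynomial.eval₂_eq', ← pow_mul,
    Finset.prod_pow_eq_pow_sum, Polynomial.finsetSum_coeff, Polynomial.coeff_zero,
    Polynomial.algebraMap_eq, Polynomial.coeff_C_mul_X_pow] at hc
  rw [Finset.sum_eq_single m₀] at hc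
  · rw [if_pos (Finset.sum_congr rfl fun i _ => mul_comm _ _)] at hc
    exact MvPolynomial.mem_support_iff.1 hm₀ hc
  · intro m hm hne
    rw [if_neg]
    intro h
    refine hne (DFunLike.coe_injective (sum_mul_pow_injOn (hlt m hm) (hlt m₀ hm₀) ?_))
    rw [h]
    exact Finset.sum_congr rfl fun i _ => mul_comm _ _
  · exact fun h => absurd hm₀ h

/-- A subfield of `K(x)` of transcendence degree one over `K` which is generated by finitely many
elements embeds into `K(X)`. -/
theorem nonempty_algHom_ratFunc (r : Fin n → RatField K n) (k₀ : Fin n)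
    (hk₀ : r k₀ ∉ Set.range (algebraMap K (RatField K n)))
    (halg : ∀ z ∈ IntermediateField.adjoin K (Set.range r),
      IsAlgebraic (Algebra.adjoin K {r k₀}) z) :
    Nonempty (IntermediateField.adjoin K (Set.range r) →ₐ[K] RatFunc K) := by
  obtain ⟨⟨b, hb⟩, hint⟩ := IsLocalization.exist_integer_multiples_of_finite
    (nonZeroDivisors (MvPolynomial (Fin n) K)) r
  choose a ha using hint
  have hb0 : b ≠ 0 := nonZeroDivisors.ne_zero hb
  have hb0' := toRat_ne_zero hb0
  have hra : ∀ k, r k = toRat (a k) / toRat b := by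
    intro k
    rw [eq_div_iff hb0', mul_comm]
    exact ((ha k).trans (Algebra.smul_def b (r k))).symm
  -- Large enough that the substitution kills neither `b` nor any nonzero `a k₀ - c b` with `c ∈ K`;
  -- the image of `r k₀` is thus defined and nonconstant.
  set N := max (a k₀).totalDegree b.totalDegree + 1 with hN
  let φ : MvPolynomial (Fin n) K →ₐ[K] RatFunc K :=
    (IsScalarTower.toAlgHom K (Polynomial K) (RatFunc K)).comp (kroneckerSubst K n N)
  have hφ : ∀ F : MvPolynomial (Fin n) K, F ≠ 0 → F.totalDegree < N → φ F ≠ 0 := by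
    intro F hF hd
    exact (map_ne_zero_iff _ (IsFractionRing.injective (Polynomial K) (RatFunc K))).2
      (kroneckerSubst_ne_zero hF hd)
  have hφb : φ b ≠ 0 := hφ b hb0 (by omega)
  let B := Localization.Away b
  let ι : B →ₐ[K] RatField K n := IsLocalization.liftAlgHom (M := Submonoid.powers b)
    (f := IsScalarTower.toAlgHom K (MvPolynomial (Fin n) K) (RatField K n)) (by
      rintro ⟨_, j, rfl⟩
      exact (isUnit_iff_ne_zero.2 (by simpa using pow_ne_zero j hb0')))
  let σ : B →ₐ[K] RatFunc K := IsLocalization.liftAlgHom (M := Submonoid.powers b)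
    (f := φ) (by
      rintro ⟨_, j, rfl⟩
      exact (isUnit_iff_ne_zero.2 (by simpa using pow_ne_zero j hφb)))
  have hιa : ∀ F, ι (algebraMap _ B F) = toRat F := fun F => IsLocalization.lift_eq _ F
  have hσa : ∀ F, σ (algebraMap _ B F) = φ F := fun F => IsLocalization.lift_eq _ F
  let ρ : Fin n → B := fun k => IsLocalization.mk' B (a k) ⟨b, Submonoid.mem_powers b⟩
  have hρ : ∀ k, ρ k * algebraMap _ B b = algebraMap _ B (a k) := fun k =>
    IsLocalization.mk'_spec _ _ _
  have hιρ : ι ∘ ρ = r := by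
    funext k
    rw [hra, eq_div_iff hb0', ← hιa, ← hιa, ← hρ, map_mul]
    rfl
  have hσρ : σ (ρ k₀) = φ (a k₀) / φ b := by
    rw [eq_div_iff hφb, ← hσa, ← hσa, ← hρ, map_mul]
  have hιinj : Function.Injective ι := by
    rw [injective_iff_map_eq_zero]
    intro z hz
    obtain ⟨F, s, rfl⟩ := IsLocalization.exists_mk'_eq (Submonoid.powers b) z
    have h1 := congrArg ι (IsLocalization.mk'_spec B F s)
    rw [map_mul, hz, zero_mul, hιa] at h1
    rw [toRat_injective (h1.symm.trans (map_zero _).symm), IsLocalization.mk'_zero]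
  have htr : Transcendental K (σ (ρ k₀)) := by
    apply RatFunc.transcendental_of_ne_C
    rintro ⟨c, hc⟩
    rw [hσρ, div_eq_iff hφb, ← RatFunc.algebraMap_eq_C] at hc
    have h1 : φ (a k₀ - MvPolynomial.C c * b) = 0 := by
      rw [map_sub, map_mul, hc, ← MvPolynomial.algebraMap_eq, AlgHom.commutes, sub_self]
    have h2 : a k₀ - MvPolynomial.C c * b = 0 := by
      by_contra h
      refine hφ _ h ?_ h1
      refine Nat.lt_succ_of_le ((MvPolynomial.totalDegree_sub _ _).trans
        (max_le_max le_rfl ((MvPolynomial.totalDegree_mul _ _).trans ?_)))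
      rw [MvPolynomial.totalDegree_C, zero_add]
    apply hk₀
    refine ⟨c, ?_⟩
    rw [hra, sub_eq_zero.1 h2, toRat, map_mul, mul_div_cancel_right₀ _ hb0',
      ← MvPolynomial.algebraMap_eq]
    exact IsScalarTower.algebraMap_apply K (MvPolynomial (Fin n) K) (RatField K n) c
  have := nonempty_algHom_adjoin_of_transcendental ι hιinj σ ρ k₀ htr (by
    have : ι (ρ k₀) = r k₀ := congrFun hιρ k₀
    rw [hιρ, this]
    exact fun z hz => halg z (IntermediateField.algebra_adjoin_le_adjoin _ _ hz))
  rwa [hιρ] at this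

/-- Lüroth's theorem for subfields of `K(x_1, …, x_n)` of transcendence degree one. -/
theorem exists_adjoin_eq_adjoin_simple (r : Fin n → RatField K n) (k₀ : Fin n)
    (hk₀ : r k₀ ∉ Set.range (algebraMap K (RatField K n)))
    (halg : ∀ z ∈ IntermediateField.adjoin K (Set.range r),
      IsAlgebraic (Algebra.adjoin K {r k₀}) z) :
    ∃ θ : RatField K n, IntermediateField.adjoin K (Set.range r) =
      IntermediateField.adjoin K {θ} := by
  obtain ⟨σ⟩ := nonempty_algHom_ratFunc r k₀ hk₀ halg
  set L := IntermediateField.adjoin K (Set.range r)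
  -- The Lüroth generator of the image in `K(X)` is pulled back along the embedding `σ`.
  have hgen := RatFunc.Luroth.generator_mem (E := σ.fieldRange)
  obtain ⟨θ, hθ⟩ := hgen
  refine ⟨θ, le_antisymm ?_ (IntermediateField.adjoin_simple_le_iff.2 θ.2)⟩
  intro z hz
  have h1 : σ ⟨z, hz⟩ ∈ σ.fieldRange := ⟨_, rfl⟩
  rw [RatFunc.Luroth.eq_adjoin_generator (E := σ.fieldRange),
    IntermediateField.mem_adjoin_simple_iff] at h1
  obtain ⟨u, v, huv⟩ := h1
  rw [IntermediateField.mem_adjoin_simple_iff]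
  refine ⟨u, v, ?_⟩
  have h2 : (⟨z, hz⟩ : L) = Polynomial.aeval θ u / Polynomial.aeval θ v := by
    apply σ.toRingHom.injective
    change σ _ = σ _
    rw [huv, map_div₀, ← Polynomial.aeval_algHom_apply, ← Polynomial.aeval_algHom_apply]
    have : σ θ = RatFunc.Luroth.generator σ.fieldRange := hθ
    rw [this]
  have h3 := congrArg (algebraMap L (RatField K n)) h2
  rw [map_div₀, ← Polynomial.aeval_algebraMap_apply, ← Polynomial.aeval_algebraMap_apply] at h3
  exact h3

end Embedding

/-! ### From the transcendence degree bound to a rational curve. -/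

section Parametrization

variable {K : Type*} [Field K] {n : ℕ}

/-- The element `t H i₀` is transcendental over `K(x)`. Two independent elements of the field of
ratios, together with it, would be three independent elements of `K(tH)`. -/
theorem isAlgebraic_of_trdegScaled_le_two {H : Fin n → RatField K n} (htr : trdegScaled H ≤ 2)
    {i₀ : Fin n} (hi₀ : H i₀ ≠ 0) {a b : RatField K n}
    (ha : a ∈ IntermediateField.adjoin K (Set.range fun k => H k / H i₀))
    (hb : b ∈ IntermediateField.adjoin K (Set.range fun k => H k / H i₀))
    (hat : Transcendental K a) : IsAlgebraic (Algebra.adjoin K {a}) b := by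
  by_contra hbt
  let E := RatFunc (RatField K n)
  let ι : RatField K n →ₐ[K] E := IsScalarTower.toAlgHom K (RatField K n) E
  let y : Option Unit → RatField K n := fun o => o.elim b fun _ => a
  have hy : AlgebraicIndependent K y := by
    refine (AlgebraicIndependent.option_iff_transcendental (x := fun _ : Unit => a) ?_ b).2 ?_
    · exact algebraicIndependent_unique_type_iff.2 hat
    · rw [Set.range_const]
      exact hbt
  set T : E := RatFunc.X * algebraMap (RatField K n) E (H i₀) with hT
  have hι0 : algebraMap (RatField K n) E (H i₀) ≠ 0 := (map_ne_zero _).2 hi₀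
  have hTt : Transcendental (RatField K n) T := by
    apply RatFunc.transcendental_of_ne_C
    rintro ⟨c, hc⟩
    refine (Polynomial.transcendental_X (R := RatField K n)) ?_
    have hX : (RatFunc.X : E) = algebraMap (RatField K n) E (c / H i₀) := by
      rw [map_div₀, eq_div_iff hι0, ← hT, hc, RatFunc.algebraMap_eq_C]
    have halg : IsAlgebraic (RatField K n) (RatFunc.X : E) := hX ▸ isAlgebraic_algebraMap _
    rw [← RatFunc.algebraMap_X] at halg
    exact (isAlgebraic_algebraMap_iff
      (IsFractionRing.injective (Polynomial (RatField K n)) E)).1 halg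
  have hz := AlgebraicIndependent.sumElim_comp hy
    (algebraicIndependent_unique_type_iff (ι := Unit) (x := fun _ => T).2 hTt)
  set M := IntermediateField.adjoin K (Set.range fun k : Fin n =>
    (RatFunc.X * algebraMap (RatField K n) E (H k) : E)) with hM
  have hTM : T ∈ M := IntermediateField.subset_adjoin _ _ ⟨i₀, rfl⟩
  have hle : IntermediateField.adjoin K (Set.range fun k => H k / H i₀) ≤ M.comap ι := by
    rw [IntermediateField.adjoin_le_iff]
    rintro _ ⟨k, rfl⟩
    have hk : (RatFunc.X * algebraMap (RatField K n) E (H k) : E) ∈ M :=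
      IntermediateField.subset_adjoin _ _ ⟨k, rfl⟩
    have h1 : ι (H k / H i₀) = (RatFunc.X * algebraMap (RatField K n) E (H k) : E) / T := by
      rw [hT, mul_div_mul_left _ _ RatFunc.X_ne_zero, map_div₀]
      rfl
    change ι (H k / H i₀) ∈ M
    rw [h1]
    exact div_mem hk hTM
  have hmem : ∀ o, Sum.elim (fun _ : Unit => T) (algebraMap (RatField K n) E ∘ y) o ∈ M := by
    rintro (_ | _ | _)
    · exact hTM
    · exact hle hb
    · exact hle ha
  have hz' : AlgebraicIndependent K (fun o => (⟨_, hmem o⟩ : M)) :=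
    AlgebraicIndependent.of_comp M.val hz
  have h3 := hz'.lift_cardinalMk_le_trdeg
  have h4 := h3.trans (Cardinal.lift_le.2 htr)
  have h5 : Cardinal.mk (Unit ⊕ Option Unit) = 3 := by
    rw [Cardinal.mk_fintype]
    rfl
  rw [h5] at h4
  norm_num at h4

/-- The field `K` is algebraically closed in `K(x)`. -/
theorem mem_range_algebraMap_of_isAlgebraic {r : RatField K n} (hr : IsAlgebraic K r) :
    r ∈ Set.range (algebraMap K (RatField K n)) := by
  obtain ⟨F, rfl⟩ := IsIntegrallyClosed.algebraMap_eq_of_integral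
    (R := MvPolynomial (Fin n) K) hr.isIntegral.tower_top
  have hF : IsAlgebraic K F := (isAlgebraic_algebraMap_iff toRat_injective).1 hr
  -- An algebraic element of `K[X]` is constant, and Kronecker's substitution is faithful up to the
  -- degree of `F`, so `F` equals that constant.
  have hκ := hF.algHom (kroneckerSubst K n (F.totalDegree + 1))
  have hdeg : (kroneckerSubst K n (F.totalDegree + 1) F).natDegree = 0 := by
    by_contra h
    exact Polynomial.transcendental _ h (mem_nonZeroDivisors_of_ne_zero (by
      rw [Polynomial.leadingCoeff_ne_zero]
      rintro h0
      simp [h0] at h)) hκ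
  have h0 : F - MvPolynomial.C ((kroneckerSubst K n (F.totalDegree + 1) F).coeff 0) = 0 := by
    by_contra h
    refine kroneckerSubst_ne_zero (N := F.totalDegree + 1) h ?_ ?_
    · refine Nat.lt_succ_of_le ((MvPolynomial.totalDegree_sub _ _).trans ?_)
      rw [MvPolynomial.totalDegree_C]
      exact max_le le_rfl (Nat.zero_le _)
    · rw [map_sub, ← MvPolynomial.algebraMap_eq, AlgHom.commutes, Polynomial.algebraMap_eq,
        ← Polynomial.eq_C_of_natDegree_eq_zero hdeg, sub_self]
  refine ⟨(kroneckerSubst K n (F.totalDegree + 1) F).coeff 0, ?_⟩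
  rw [IsScalarTower.algebraMap_apply K (MvPolynomial (Fin n) K) (RatField K n),
    MvPolynomial.algebraMap_eq, ← sub_eq_zero.1 h0]

theorem exists_primitive_of_ne_zero {f : Fin n → Polynomial K} (hf : f ≠ 0) :
    ∃ (d : Polynomial K) (e : Fin n → Polynomial K),
      (∀ k, f k = d * e k) ∧ IsPrimitiveTuple e := by
  obtain ⟨d, hd⟩ := (IsPrincipalIdealRing.principal (Ideal.span (Set.range f))).principal
  have hdvd : ∀ k, d ∣ f k := fun k => by
    rw [← Ideal.mem_span_singleton]
    have hk : f k ∈ Ideal.span (Set.range f) := Ideal.subset_span ⟨k, rfl⟩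
    rwa [hd] at hk
  choose e he using hdvd
  have hd0 : d ≠ 0 := by
    rintro rfl
    exact hf (funext fun k => by simp [he])
  refine ⟨d, e, he, fun c hc => ?_⟩
  have h1 : d * c ∣ d := by
    have : d ∈ Ideal.span (Set.range f) := hd ▸ Ideal.mem_span_singleton_self d
    rw [← Ideal.mem_span_singleton]
    refine (Ideal.span_le.2 ?_) this
    rintro _ ⟨k, rfl⟩
    rw [SetLike.mem_coe, Ideal.mem_span_singleton, he]
    exact mul_dvd_mul_left _ (hc k)
  exact isUnit_of_dvd_one ((mul_dvd_mul_iff_left hd0).1 (by simpa using h1))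

theorem isPrimitiveTuple_C {c : Fin n → K} (hc : c ≠ 0) :
    IsPrimitiveTuple fun k => Polynomial.C (c k) := by
  obtain ⟨k, hk⟩ := Function.ne_iff.1 hc
  exact fun d hd => isUnit_of_dvd_unit (hd k) (Polynomial.isUnit_C.2 (isUnit_iff_ne_zero.2 hk))

/-- A nonzero tuple with `trdeg K(tH) ≤ 2` is a multiple of a curve evaluated in a fraction. -/
theorem exists_parametrization {H : Fin n → RatField K n} (htr : trdegScaled H ≤ 2)
    (hH : H ≠ 0) :
    ∃ (f : Fin n → Polynomial K) (p q : MvPolynomial (Fin n) K) (g : RatField K n),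
      q ≠ 0 ∧ IsRelPrime p q ∧ IsPrimitiveTuple f ∧
      (∀ k, H k = g * Polynomial.aeval (toRat p / toRat q) (f k)) ∧
      ((∀ k, derivative (f k) = 0) ∨ Transcendental K (toRat p / toRat q : RatField K n)) := by
  classical
  obtain ⟨i₀, hi₀⟩ := Function.ne_iff.1 hH
  have hi₀' : H i₀ ≠ 0 := hi₀
  by_cases hc : ∀ k, H k / H i₀ ∈ Set.range (algebraMap K (RatField K n))
  · choose c hc using hc
    -- If all ratios are constants, the curve is a point and `0/1` serves as a dummy parameter.
    refine ⟨fun k => Polynomial.C (c k), 0, 1, H i₀, one_ne_zero, isRelPrime_one_right,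
      isPrimitiveTuple_C ?_, fun k => ?_, Or.inl fun k => Polynomial.derivative_C⟩
    · intro h0
      have := hc i₀
      rw [h0, Pi.zero_apply, map_zero, div_self hi₀'] at this
      exact zero_ne_one this
    · rw [Polynomial.aeval_C, hc, mul_div_cancel₀ _ hi₀']
  push Not at hc
  obtain ⟨k₀, hk₀⟩ := hc
  set r : Fin n → RatField K n := fun k => H k / H i₀ with hr
  have hrmem : ∀ k, r k ∈ IntermediateField.adjoin K (Set.range r) := fun k =>
    IntermediateField.subset_adjoin _ _ ⟨k, rfl⟩
  have hkt : Transcendental K (r k₀) := fun h => hk₀ (mem_range_algebraMap_of_isAlgebraic h)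
  obtain ⟨θ, hθ⟩ := exists_adjoin_eq_adjoin_simple r k₀ hk₀ fun z hz =>
    isAlgebraic_of_trdegScaled_le_two htr hi₀' (hrmem k₀) hz hkt
  have hθt : Transcendental K θ := by
    intro h
    have h1 := hrmem k₀
    rw [hθ] at h1
    have := IntermediateField.isAlgebraic_adjoin_simple h.isIntegral
    have h2 := Algebra.IsAlgebraic.isAlgebraic (R := K)
      (⟨r k₀, h1⟩ : IntermediateField.adjoin K {θ})
    exact hkt (IntermediateField.isAlgebraic_iff.1 h2)
  have hmem := fun k => (IntermediateField.mem_adjoin_simple_iff K (r k)).1 (hθ ▸ hrmem k)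
  choose u v huv using hmem
  have hr0 : r i₀ = 1 := div_self hi₀'
  -- The denominators `v k` may be zero, the quotient then being `0` by convention; such quotients
  -- are rewritten as `0/1`.
  let w : Fin n → Polynomial K := fun k => if v k = 0 then 1 else v k
  have hw : ∀ k, w k ≠ 0 := fun k => by
    simp only [w]
    split_ifs with h
    · exact one_ne_zero
    · exact h
  let u' : Fin n → Polynomial K := fun k => if v k = 0 then 0 else u k
  have huw : ∀ k, r k = Polynomial.aeval θ (u' k) / Polynomial.aeval θ (w k) := fun k => by
    simp only [w, u']
    rw [huv]
    split_ifs with h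
    · simp [h]
    · rfl
  have hne : ∀ {P : Polynomial K}, P ≠ 0 → Polynomial.aeval θ P ≠ 0 := fun hP h =>
    hθt ⟨_, hP, h⟩
  set W := ∏ k, w k with hW
  have hW0 : W ≠ 0 := Finset.prod_ne_zero_iff.2 fun k _ => hw k
  have hdvd : ∀ k, w k ∣ W := fun k => Finset.dvd_prod_of_mem _ (Finset.mem_univ k)
  choose z hz using hdvd
  have hrz : ∀ k, r k * Polynomial.aeval θ W = Polynomial.aeval θ (u' k * z k) := by
    intro k
    have hwk := hne (hw k)
    rw [hz k, huw, map_mul, map_mul]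
    field_simp
  obtain ⟨d, f, hdf, hf⟩ := exists_primitive_of_ne_zero (f := fun k => u' k * z k) (by
    intro h0
    have h1 := hrz i₀
    rw [hr0, one_mul] at h1
    have h2 : u' i₀ * z i₀ = 0 := congrFun h0 i₀
    rw [h2, map_zero] at h1
    exact hne hW0 h1)
  obtain ⟨p, q, hpq, hq, hθpq⟩ : ∃ p q : MvPolynomial (Fin n) K, IsRelPrime p q ∧ q ≠ 0 ∧
      toRat p / toRat q = θ :=
    ⟨IsFractionRing.num (MvPolynomial (Fin n) K) θ,
      (IsFractionRing.den (MvPolynomial (Fin n) K) θ : MvPolynomial (Fin n) K),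
      IsFractionRing.num_den_reduced _ θ,
      nonZeroDivisors.coe_ne_zero _, IsFractionRing.mk'_num_den' (A := MvPolynomial (Fin n) K) θ⟩
  refine ⟨f, p, q, H i₀ * Polynomial.aeval θ d / Polynomial.aeval θ W, hq, hpq, hf, fun k => ?_,
    Or.inr (hθpq ▸ hθt)⟩
  have h1 := hrz k
  rw [show u' k * z k = d * f k from hdf k, map_mul] at h1
  have h2 : H k = r k * H i₀ := (div_mul_cancel₀ _ hi₀').symm
  rw [hθpq, div_mul_eq_mul_div, eq_div_iff (hne hW0), h2]
  linear_combination H i₀ * h1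

end Parametrization

/-! ### The implication (1) ⇒ (5). -/

section FractionForm

variable {K : Type*} [Field K] {n : ℕ}

theorem IsPrimitiveTuple.dvd_of_forall_dvd_mul {R : Type*} [CommRing R] [IsDomain R]
    [UniqueFactorizationMonoid R] {m : ℕ} {v : Fin m → R} (hv : IsPrimitiveTuple v) {d e : R}
    (hd : d ≠ 0) (h : ∀ k, d ∣ v k * e) : d ∣ e := by
  obtain ⟨d', e', c, hrel, rfl, rfl⟩ := UniqueFactorizationMonoid.exists_reduced_factors d hd e
  have hc : c ≠ 0 := left_ne_zero_of_mul hd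
  have hunit : IsUnit d' := hv d' fun k => by
    have h1 := h k
    rw [mul_left_comm, mul_dvd_mul_iff_left hc] at h1
    exact hrel.dvd_of_dvd_mul_right h1
  exact mul_dvd_mul_left _ hunit.dvd

/-- Vanishing minors give `f k ∣ f l · (f k)'` for all `l`, hence `f k ∣ (f k)'` by primitivity,
which is impossible by degree unless the derivative is zero. -/
theorem derivative_eq_zero_of_minors_eq_zero {f : Fin n → Polynomial K} (hf : IsPrimitiveTuple f)
    (h : ∀ k l, f k * derivative (f l) - derivative (f k) * f l = 0) (k : Fin n) :
    derivative (f k) = 0 := by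
  by_cases hk : f k = 0
  · rw [hk, map_zero]
  have hdvd : f k ∣ derivative (f k) := hf.dvd_of_forall_dvd_mul hk fun l =>
    ⟨derivative (f l), by linear_combination -h k l⟩
  by_contra h0
  exact absurd (Polynomial.degree_le_of_dvd hdvd h0)
    (not_le.2 (Polynomial.degree_derivative_lt hk))

/-- In characteristic `ℓ > 0`, `f(y) = e(y^ℓ)`, and `e` with `p^ℓ`, `q^ℓ` works because `ℓ`-th
powers have zero gradient. In characteristic zero `f` is constant and `0/1` will do. -/
theorem exists_isFractionForm_of_derivative_eq_zero {H : Fin n → RatField K n}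
    {f : Fin n → Polynomial K} {p q : MvPolynomial (Fin n) K} {g : RatField K n}
    (hq : q ≠ 0) (hpq : IsRelPrime p q) (hf : IsPrimitiveTuple f)
    (hH : ∀ k, H k = g * Polynomial.aeval (toRat p / toRat q) (f k))
    (hder : ∀ k, derivative (f k) = 0) :
    ∃ (f : Fin n → Polynomial K) (p q : MvPolynomial (Fin n) K),
      IsFractionForm H f p q ∧ IsPrimitiveTuple f ∧ IsRelPrime p q := by
  obtain ⟨ℓ, hℓ⟩ := CharP.exists K
  rcases CharP.char_is_prime_or_zero K ℓ with hprime | rfl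
  · have hexp : ∀ k, Polynomial.expand K ℓ (Polynomial.contract ℓ (f k)) = f k := fun k =>
      Polynomial.expand_contract ℓ (hder k) hprime.ne_zero
    have hgrad : ∀ (u : MvPolynomial (Fin n) K) i, pderiv i (u ^ ℓ) = 0 := fun u i => by
      rw [Derivation.leibniz_pow, ← Nat.cast_smul_eq_nsmul (MvPolynomial (Fin n) K),
        CharP.cast_eq_zero, zero_smul]
    refine ⟨fun k => Polynomial.contract ℓ (f k), p ^ ℓ, q ^ ℓ,
      ⟨pow_ne_zero _ hq, ⟨g, fun k => ?_⟩, by simp [hgrad], by simp [hgrad]⟩,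
      fun d hd => ?_, hpq.pow⟩
    · rw [hH, ← hexp k, Polynomial.expand_aeval, div_pow, toRat, toRat, toRat, toRat,
        map_pow, map_pow]
    · have h1 := hf (Polynomial.expand K ℓ d) fun k => by
        rw [← hexp k]
        exact map_dvd _ (hd k)
      rw [Polynomial.isUnit_iff_degree_eq_zero] at h1 ⊢
      have hd0 : d ≠ 0 := by
        rintro rfl
        simp at h1
      rw [Polynomial.degree_eq_natDegree hd0]
      have h2 := Polynomial.natDegree_eq_of_degree_eq_some h1
      rw [Polynomial.natDegree_expand] at h2
      rw [(Nat.mul_eq_zero.1 h2).resolve_right hprime.ne_zero]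
      rfl
  · have := CharP.charP_to_charZero K
    refine ⟨f, 0, 1, ⟨one_ne_zero, ⟨g, fun k => ?_⟩, by simp, by simp⟩, hf, isRelPrime_one_right⟩
    rw [hH, Polynomial.eq_C_of_natDegree_eq_zero
      (Polynomial.derivative_eq_zero.1 (hder k)), Polynomial.aeval_C,
      Polynomial.aeval_C]

theorem JacobianTraceEq.exists_isFractionForm (hn : 1 ≤ n) {H : Fin n → RatField K n}
    (htr : trdegScaled H ≤ 2) (h : JacobianTraceEq H) :
    ∃ (f : Fin n → Polynomial K) (p q : MvPolynomial (Fin n) K),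
      IsFractionForm H f p q ∧ IsPrimitiveTuple f ∧ IsRelPrime p q := by
  obtain rfl | hH := eq_or_ne H 0
  · refine ⟨fun _ => Polynomial.C 1, 0, 1, ⟨one_ne_zero, ⟨0, by simp⟩, by simp, by simp⟩,
      isPrimitiveTuple_C (c := fun _ => 1) fun h0 => ?_, isRelPrime_one_right⟩
    exact one_ne_zero (congrFun h0 ⟨0, hn⟩)
  obtain ⟨f, p, q, g, hq, hpq, hf, hHf, hcase⟩ := exists_parametrization htr hH
  by_cases hder : ∀ k, derivative (f k) = 0
  · exact exists_isFractionForm_of_derivative_eq_zero hq hpq hf hHf hder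
  have hθ := hcase.resolve_left hder
  set θ : RatField K n := toRat p / toRat q with hθdef
  obtain ⟨k, l, hkl⟩ : ∃ k l, f k * derivative (f l) - derivative (f k) * f l ≠ 0 := by
    by_contra! h0
    exact hder (derivative_eq_zero_of_minors_eq_zero hf h0)
  have hkl' : Polynomial.aeval θ (f k) * Polynomial.aeval θ (derivative (f l)) -
      Polynomial.aeval θ (derivative (f k)) * Polynomial.aeval θ (f l) ≠ 0 := by
    rw [← map_mul, ← map_mul, ← map_sub]
    exact fun h0 => hθ ⟨_, hkl, h0⟩
  have hg : g ≠ 0 := by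
    rintro rfl
    exact hH (funext fun k => by simp [hHf])
  obtain rfl : H = g • fun k => Polynomial.aeval θ (f k) := funext hHf
  rw [jacobianTraceEq_smul_iff hg, jacobianTraceEq_aeval_iff] at h
  -- The trace condition is a linear relation between the independent vectors `f(θ)` and `f'(θ)`, so
  -- both coefficients vanish: `θ` is a double root.
  obtain ⟨h1, h2⟩ := eq_zero_of_smul_add_smul_eq_zero
    (u := fun i => Polynomial.aeval θ (f i)) (v := fun i => Polynomial.aeval θ (derivative (f i)))
    hkl' (a := -dirDeriv (fun i => Polynomial.aeval θ (derivative (f i))) θ)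
    (b := dirDeriv (fun i => Polynomial.aeval θ (f i)) θ) fun i => by linear_combination h i
  obtain ⟨h3, h4⟩ := gradDot_eq_zero_of_double_root hpq hq h2 (neg_eq_zero.1 h1)
  exact ⟨f, p, q, ⟨hq, ⟨g, hHf⟩, h3, h4⟩, hf, hpq⟩

end FractionForm

/-! ### The implication (5) ⇒ (2), through `q ^ s f(p / q)`. -/

section Homogenization

variable {K : Type*} [Field K] {n : ℕ}

/-- The derivative in the direction of a constant vector. -/
def constDeriv (c : Fin n → K) :
    Derivation K (MvPolynomial (Fin n) K) (MvPolynomial (Fin n) K) :=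
  ∑ i, (MvPolynomial.C (c i) : MvPolynomial (Fin n) K) • pderiv i

theorem constDeriv_apply (c : Fin n → K) (u : MvPolynomial (Fin n) K) :
    constDeriv c u = ∑ i, pderiv i u * MvPolynomial.C (c i) := by
  change Derivation.coeFnAddMonoidHom (constDeriv c) u = _
  rw [constDeriv, map_sum, Finset.sum_apply]
  exact Finset.sum_congr rfl fun i _ => mul_comm _ _

/-- The polynomial `q ^ s f(p / q)`. -/
def homogenized (s : ℕ) (f : Polynomial K) (p q : MvPolynomial (Fin n) K) :
    MvPolynomial (Fin n) K :=
  ∑ j ∈ Finset.range (s + 1), MvPolynomial.C (f.coeff j) * (p ^ j * q ^ (s - j))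

theorem toRat_homogenized {s : ℕ} {f : Polynomial K} (hf : f.natDegree ≤ s)
    (p : MvPolynomial (Fin n) K) {q : MvPolynomial (Fin n) K} (hq : q ≠ 0) :
    toRat (homogenized s f p q) = toRat q ^ s * Polynomial.aeval (toRat p / toRat q) f := by
  have hq' := toRat_ne_zero hq
  rw [Polynomial.aeval_eq_sum_range' (Nat.lt_succ_of_le hf), Finset.mul_sum, homogenized, toRat,
    map_sum]
  refine Finset.sum_congr rfl fun j hj => ?_
  have hjs : j ≤ s := Nat.lt_succ_iff.1 (Finset.mem_range.1 hj)
  rw [map_mul, map_mul, map_pow, map_pow, Algebra.smul_def, ← MvPolynomial.algebraMap_eq,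
    ← IsScalarTower.algebraMap_apply, div_pow]
  have h1 : toRat q ^ s = toRat q ^ (s - j) * toRat q ^ j := by
    rw [← pow_add, Nat.sub_add_cancel hjs]
  rw [h1]
  field_simp

theorem constDeriv_pow_mul_pow {c : Fin n → K} {p q : MvPolynomial (Fin n) K}
    (hp : constDeriv c p = 0) (hq : constDeriv c q = 0) (a b : ℕ) :
    constDeriv c (p ^ a * q ^ b) = 0 := by
  rw [Derivation.leibniz, Derivation.leibniz_pow, Derivation.leibniz_pow, hp, hq]
  simp

theorem constDeriv_homogenized {c : Fin n → K} {p q : MvPolynomial (Fin n) K}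
    (hp : constDeriv c p = 0) (hq : constDeriv c q = 0) (s : ℕ) (f : Polynomial K) :
    constDeriv c (homogenized s f p q) = 0 := by
  rw [homogenized, map_sum]
  refine Finset.sum_eq_zero fun j _ => ?_
  rw [Derivation.leibniz, constDeriv_pow_mul_pow hp hq, ← MvPolynomial.algebraMap_eq,
    Derivation.map_algebraMap, smul_zero, smul_zero, add_zero]

variable {f : Fin n → Polynomial K} {p q : MvPolynomial (Fin n) K}

theorem constDeriv_eq_zero_of_gradDot {u : MvPolynomial (Fin n) K} (hu : gradDot u f = 0) (j : ℕ) :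
    constDeriv (fun i => (f i).coeff j) u = 0 := by
  rw [constDeriv_apply, ← coeff_gradDot, hu, Polynomial.coeff_zero]

/-- Directional derivatives along `q ^ s f(p / q)` are combinations of those along the
coefficient vectors of `f`. -/
theorem sum_mul_homogenized {R : Type*} [CommRing R] [Algebra K R]
    (σ : MvPolynomial (Fin n) K →ₐ[K] R) (a : Fin n → R) (s : ℕ)
    (h : ∀ j, ∑ i, a i * algebraMap K R ((f i).coeff j) = 0) :
    ∑ i, a i * σ (homogenized s (f i) p q) = 0 := by
  simp only [homogenized, map_sum, Finset.mul_sum]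
  rw [Finset.sum_comm]
  refine Finset.sum_eq_zero fun j _ => ?_
  have : ∀ i, a i * σ (MvPolynomial.C ((f i).coeff j) * (p ^ j * q ^ (s - j))) =
      a i * algebraMap K R ((f i).coeff j) * σ (p ^ j * q ^ (s - j)) := fun i => by
    rw [map_mul, ← MvPolynomial.algebraMap_eq, AlgHom.commutes, mul_assoc]
  simp only [this]
  rw [← Finset.sum_mul, h, zero_mul]

theorem sum_pderiv_mul_homogenized {u : MvPolynomial (Fin n) K} (s : ℕ)
    (h : ∀ j, constDeriv (fun i => (f i).coeff j) u = 0) :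
    ∑ i, pderiv i u * homogenized s (f i) p q = 0 :=
  sum_mul_homogenized (AlgHom.id K _) _ s fun j => by
    rw [← h j, constDeriv_apply, MvPolynomial.algebraMap_eq]

theorem sum_pderiv_homogenized (hp : gradDot p f = 0) (hq : gradDot q f = 0) (s : ℕ) :
    ∑ i, pderiv i (homogenized s (f i) p q) = 0 := by
  simp only [homogenized, map_sum]
  rw [Finset.sum_comm]
  refine Finset.sum_eq_zero fun j _ => ?_
  rw [← constDeriv_pow_mul_pow (constDeriv_eq_zero_of_gradDot hp j)
    (constDeriv_eq_zero_of_gradDot hq j) j (s - j), constDeriv_apply]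
  refine Finset.sum_congr rfl fun i _ => ?_
  rw [MvPolynomial.pderiv_C_mul, mul_comm]

/-- If `P` is primitive, a scalar `c` for which `c P` is a polynomial tuple is a polynomial. -/
theorem IsPrimitiveTuple.exists_eq_toRat {P Q : Fin n → MvPolynomial (Fin n) K}
    (hP : IsPrimitiveTuple P) {c : RatField K n} (h : ∀ k, toRat (Q k) = c * toRat (P k)) :
    ∃ d, c = toRat d := by
  obtain ⟨a, b, hb, rfl⟩ := exists_eq_toRat_div c
  have hb' := toRat_ne_zero hb
  obtain ⟨d, rfl⟩ : b ∣ a := hP.dvd_of_forall_dvd_mul hb fun k => ⟨Q k, toRat_injective (by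
    have := h k
    simp only [map_mul]
    rw [div_mul_eq_mul_div, eq_div_iff hb'] at this
    linear_combination -this)⟩
  exact ⟨d, by simp only [map_mul]; field_simp⟩

theorem IsPrimitivePart.eq_mul {H : Fin n → RatField K n} {P : Fin n → MvPolynomial (Fin n) K}
    (hP : IsPrimitivePart H P) (hH : H ≠ 0) :
    IsPrimitiveTuple P ∧ ∃ c : RatField K n, c ≠ 0 ∧ ∀ k, H k = c * toRat (P k) := by
  obtain ⟨h0, -⟩ | ⟨-, hprim, c, hc⟩ := hP
  · exact absurd h0 hH
  have hc0 : c ≠ 0 := by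
    rintro rfl
    refine not_isUnit_zero (hprim 0 fun k => ?_)
    rw [zero_dvd_iff]
    exact toRat_injective (by simpa using hc k)
  exact ⟨hprim, c⁻¹, inv_ne_zero hc0, fun k => by rw [hc, inv_mul_cancel_left₀ hc0]⟩

theorem IsFractionForm.jacobianSeparatedZero {H : Fin n → RatField K n}
    {P : Fin n → MvPolynomial (Fin n) K} (hP : IsPrimitivePart H P)
    (h : IsFractionForm H f p q) : JacobianSeparatedZero P := by
  obtain rfl | hH := eq_or_ne H 0
  · obtain ⟨-, rfl⟩ | ⟨h0, -⟩ := hP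
    · constructor
      · funext k
        simp [Matrix.mulVec, dotProduct]
      · funext k
        simp
    · exact absurd rfl h0
  obtain ⟨hprim, c, hc0, hc⟩ := hP.eq_mul hH
  obtain ⟨hq, ⟨g, hg⟩, hp0, hq0⟩ := h
  change gradDot p f = 0 at hp0
  change gradDot q f = 0 at hq0
  have hg0 : g ≠ 0 := by
    rintro rfl
    exact hH (funext fun k => by simp [hg])
  set s := Finset.univ.sup fun k => (f k).natDegree
  have hs : ∀ k, (f k).natDegree ≤ s := fun k =>
    Finset.le_sup (f := fun k => (f k).natDegree) (Finset.mem_univ k)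
  have hR : ∀ k, toRat (homogenized s (f k) p q) = (toRat q ^ s * c / g) * toRat (P k) := by
    intro k
    have h1 : g * Polynomial.aeval (toRat p / toRat q) (f k) = c * toRat (P k) := by
      rw [← hg, hc]
    rw [toRat_homogenized (hs k) p hq]
    field_simp
    linear_combination toRat q ^ s * h1
  -- The polynomial tuple `q ^ s f(p / q)` is a multiple of the primitive `P`, so the factor `d` is
  -- itself a polynomial.
  obtain ⟨d, hd⟩ := hprim.exists_eq_toRat hR
  have hd0 : d ≠ 0 := by
    rintro rfl
    rw [show toRat (0 : MvPolynomial (Fin n) K) = 0 from map_zero _] at hd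
    exact div_ne_zero (mul_ne_zero (pow_ne_zero _ (toRat_ne_zero hq)) hc0) hg0 hd
  have hRP : ∀ k, homogenized s (f k) p q = d * P k := fun k => toRat_injective (by
    rw [hR, hd]; simp only [map_mul])
  have hDR : ∀ j k, constDeriv (fun i => (f i).coeff j) (d * P k) = 0 := fun j k => by
    rw [← hRP]
    exact constDeriv_homogenized (constDeriv_eq_zero_of_gradDot hp0 j)
      (constDeriv_eq_zero_of_gradDot hq0 j) s (f k)
  -- From `D(d P k) = 0` for all `k`, `d` divides every `P k · D d`, hence `D d` by primitivity; the
  -- degree of `D d` is too small unless it is zero.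
  have hDd : ∀ j, constDeriv (fun i => (f i).coeff j) d = 0 := fun j => by
    rw [constDeriv_apply]
    apply sum_pderiv_mul_C_eq_zero_of_dvd
    rw [← constDeriv_apply]
    refine hprim.dvd_of_forall_dvd_mul hd0 fun k =>
      ⟨-constDeriv (fun i => (f i).coeff j) (P k), ?_⟩
    have := hDR j k
    rw [Derivation.leibniz, smul_eq_mul, smul_eq_mul] at this
    linear_combination this
  have hDP : ∀ j k, constDeriv (fun i => (f i).coeff j) (P k) = 0 := fun j k => by
    have := hDR j k
    rw [Derivation.leibniz, hDd, smul_zero, add_zero, smul_eq_mul] at this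
    exact (mul_eq_zero.1 this).resolve_left hd0
  have htrace : ∑ k, pderiv k (P k) = 0 := by
    have h1 := sum_pderiv_homogenized hp0 hq0 s
    have h2 := sum_pderiv_mul_homogenized (p := p) (q := q) (u := d) s hDd
    simp only [hRP, Derivation.leibniz, smul_eq_mul, Finset.sum_add_distrib, ← Finset.mul_sum,
      mul_left_comm _ d] at h1 h2
    have h3 : ∑ i, P i * pderiv i d = 0 := by
      simp only [mul_comm (P _)]
      exact (mul_eq_zero.1 h2).resolve_left hd0
    rw [h3, add_zero] at h1
    exact (mul_eq_zero.1 h1).resolve_left hd0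
  constructor
  · funext k
    have hinj := MvPolynomial.rename_injective (R := K) (Sum.inr : Fin n → Fin n ⊕ Fin n)
      Sum.inr_injective
    -- The tuple `d(y) P(y)` is a combination of the coefficient vectors of `f`, all of which
    -- `JP(x)` kills; the factor `d(y)` is then cancelled.
    have h1 := sum_mul_homogenized (f := f) (p := p) (q := q) (MvPolynomial.rename Sum.inr)
      (fun i => MvPolynomial.rename (Sum.inl : Fin n → Fin n ⊕ Fin n) (pderiv i (P k))) s
      fun j => by
        have h2 := congrArg (MvPolynomial.rename (Sum.inl : Fin n → Fin n ⊕ Fin n)) (hDP j k)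
        rw [constDeriv_apply, map_sum, map_zero] at h2
        simpa only [map_mul, MvPolynomial.rename_C, MvPolynomial.algebraMap_eq] using h2
    simp only [hRP, map_mul, mul_left_comm _ (MvPolynomial.rename Sum.inr d)] at h1
    rw [← Finset.mul_sum] at h1
    exact (mul_eq_zero.1 h1).resolve_left ((map_ne_zero_iff _ hinj).2 hd0)
  · have : ((polyJacobian P).map
        (MvPolynomial.rename (Sum.inl : Fin n → Fin n ⊕ Fin n))).trace = 0 := by
      have h2 := congrArg (MvPolynomial.rename (Sum.inl : Fin n → Fin n ⊕ Fin n)) htrace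
      rw [map_sum, map_zero] at h2
      exact h2
    rw [this, zero_smul]

end Homogenization

/-! ### The homogeneous form (3), and the way back from (2) and (3) to (1). -/

section HomogeneousForm

variable {K : Type*} [Field K] {n : ℕ}

theorem JacobianTraceEq.of_polynomial_multiple {H : Fin n → RatField K n}
    {R : Fin n → MvPolynomial (Fin n) K} {c : RatField K n} (hc : c ≠ 0)
    (hH : ∀ k, H k = c * toRat (R k)) (h : JacobianTraceEq fun k => toRat (R k)) :
    JacobianTraceEq H := by
  obtain rfl : H = c • fun k => toRat (R k) := funext hH
  exact (jacobianTraceEq_smul_iff hc _).2 h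

theorem dirDeriv_toRat (R : Fin n → MvPolynomial (Fin n) K) (u : MvPolynomial (Fin n) K) :
    dirDeriv (fun k => toRat (R k)) (toRat u) = toRat (∑ i, pderiv i u * R i) := by
  simp only [dirDeriv, ratPderiv_toRat, map_sum, map_mul]

theorem JacobianSeparatedZero.jacobianTraceEq {H : Fin n → RatField K n}
    {P : Fin n → MvPolynomial (Fin n) K} (hP : IsPrimitivePart H P)
    (h : JacobianSeparatedZero P) : JacobianTraceEq H := by
  obtain rfl | hH := eq_or_ne H 0
  · exact jacobianTraceEq_zero
  obtain ⟨-, c, hc0, hc⟩ := hP.eq_mul hH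
  refine JacobianTraceEq.of_polynomial_multiple hc0 hc ((jacobianTraceEq_iff _).2 fun k => ?_)
  -- Specialization `y = x`.
  let ε : MvPolynomial (Fin n ⊕ Fin n) K →ₐ[K] MvPolynomial (Fin n) K :=
    MvPolynomial.aeval (Sum.elim MvPolynomial.X MvPolynomial.X)
  have hl : ∀ u : MvPolynomial (Fin n) K, ε (MvPolynomial.rename Sum.inl u) = u := fun u => by
    rw [MvPolynomial.aeval_rename]
    exact MvPolynomial.aeval_X_left_apply u
  have hr : ∀ u : MvPolynomial (Fin n) K, ε (MvPolynomial.rename Sum.inr u) = u := fun u => by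
    rw [MvPolynomial.aeval_rename]
    exact MvPolynomial.aeval_X_left_apply u
  have h1 : ∑ i, pderiv i (P k) * P i = 0 := by
    have := congrArg ε (congrFun h.1 k)
    simpa [Matrix.mulVec, dotProduct, polyJacobian, hl, hr] using this
  have h2 : (∑ i, pderiv i (P i)) * P k = 0 := by
    have := congrArg ε (congrFun h.2 k)
    simpa [Matrix.trace, polyJacobian, hl, hr] using this
  rw [dirDeriv_toRat, h1]
  simp only [ratPderiv_toRat, ← map_sum, ← map_mul, h2]

theorem IsFractionForm.homogeneousForm {H : Fin n → RatField K n} {f : Fin n → Polynomial K}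
    {p q : MvPolynomial (Fin n) K} (h : IsFractionForm H f p q) (hpq : IsRelPrime p q) :
    HomogeneousForm H := by
  obtain ⟨hq, ⟨g, hg⟩, hp0, hq0⟩ := h
  change gradDot p f = 0 at hp0
  change gradDot q f = 0 at hq0
  set s := Finset.univ.sup fun k => (f k).natDegree
  have hs : ∀ k, (f k).natDegree ≤ s := fun k =>
    Finset.le_sup (f := fun k => (f k).natDegree) (Finset.mem_univ k)
  -- Homogenizing in a degree one higher than necessary only adds a factor `q`, absorbed by `g`; so
  -- a degree divisible by the characteristic can be avoided.
  obtain ⟨s', hss', hchar⟩ : ∃ s', s ≤ s' ∧ (0 < s' → ¬ ringChar K ∣ s') := by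
    by_cases h1 : ringChar K ∣ s
    · refine ⟨s + 1, Nat.le_succ s, fun _ h2 => CharP.ringChar_ne_one (R := K) ?_⟩
      exact Nat.dvd_one.1 ((Nat.dvd_add_right h1).1 h2)
    · exact ⟨s, le_rfl, fun _ => h1⟩
  have haeval : ∀ k, MvPolynomial.aeval ![p, q] (homogenized s' (f k)
      (MvPolynomial.X 0 : MvPolynomial (Fin 2) K) (MvPolynomial.X 1)) =
      homogenized s' (f k) p q := fun k => by
    simp [homogenized, MvPolynomial.algebraMap_eq]
  refine ⟨fun k => homogenized s' (f k) (MvPolynomial.X 0) (MvPolynomial.X 1), s', p, q,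
    g / toRat q ^ s', fun k => ?_, hchar, hpq, fun k => ?_, ?_⟩
  · refine MvPolynomial.IsHomogeneous.sum _ _ _ fun j hj => ?_
    have hj' : j + (s' - j) = s' :=
      Nat.add_sub_cancel' (Nat.lt_succ_iff.1 (Finset.mem_range.1 hj))
    have h1 := ((MvPolynomial.isHomogeneous_X K (0 : Fin 2)).pow j).mul
      ((MvPolynomial.isHomogeneous_X K (1 : Fin 2)).pow (s' - j))
    rw [one_mul, one_mul, hj'] at h1
    simpa using (MvPolynomial.isHomogeneous_C (Fin 2) ((f k).coeff j)).mul h1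
  · rw [haeval, toRat_homogenized ((hs k).trans hss') p hq, hg]
    have := pow_ne_zero s' (toRat_ne_zero hq)
    field_simp
  · funext k
    simp only [haeval]
    exact sum_pderiv_mul_homogenized s' fun j =>
      constDeriv_homogenized (constDeriv_eq_zero_of_gradDot hp0 j)
        (constDeriv_eq_zero_of_gradDot hq0 j) s' (f k)

theorem MvPolynomial.IsHomogeneous.toRat_aeval {h : MvPolynomial (Fin 2) K} {s : ℕ}
    (hh : h.IsHomogeneous s) (p : MvPolynomial (Fin n) K) {q : MvPolynomial (Fin n) K}
    (hq : q ≠ 0) :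
    toRat (MvPolynomial.aeval ![p, q] h) = toRat q ^ s *
      Polynomial.aeval (toRat p / toRat q)
        (MvPolynomial.aeval ![(Polynomial.X : Polynomial K), 1] h) := by
  have hq' := toRat_ne_zero hq
  simp only [MvPolynomial.aeval_def, MvPolynomial.eval₂_eq', Fin.prod_univ_two, map_sum,
    Finset.mul_sum]
  refine Finset.sum_congr rfl fun d hd => ?_
  have hds : d 0 + d 1 = s := by
    by_contra h0
    refine MvPolynomial.mem_support_iff.1 hd (hh.coeff_eq_zero ?_)
    rwa [Finsupp.degree_eq_sum, Fin.sum_univ_two]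
  simp only [Matrix.cons_val_zero, Matrix.cons_val_one, one_pow, mul_one,
    map_mul, map_pow, Polynomial.algebraMap_eq, Polynomial.aeval_C, Polynomial.aeval_X, div_pow,
    ← hds, pow_add]
  rw [← IsScalarTower.algebraMap_apply]
  field_simp

theorem jacobianTraceEq_of_constant {R : Fin n → MvPolynomial (Fin n) K}
    (h : ∀ k, ∃ c, R k = MvPolynomial.C c) : JacobianTraceEq fun k => toRat (R k) := by
  rw [jacobianTraceEq_iff]
  have h0 : ∀ i k, pderiv i (R k) = 0 := fun i k => by
    obtain ⟨c, hc⟩ := h k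
    rw [hc, MvPolynomial.pderiv_C]
  intro k
  simp [dirDeriv_toRat, ratPderiv_toRat, h0]

theorem HomogeneousForm.jacobianTraceEq {H : Fin n → RatField K n} (hH : HomogeneousForm H) :
    JacobianTraceEq H := by
  obtain ⟨h, s, p, q, g, hh, hchar, hpq, hg, hJ⟩ := hH
  obtain rfl | hg0 := eq_or_ne g 0
  · obtain rfl : H = 0 := funext fun k => by simp [hg]
    exact jacobianTraceEq_zero
  obtain rfl | hs := Nat.eq_zero_or_pos s
  · refine JacobianTraceEq.of_polynomial_multiple hg0 hg (jacobianTraceEq_of_constant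
      fun k => ?_)
    rw [MvPolynomial.totalDegree_eq_zero_iff_eq_C.1
      ((MvPolynomial.totalDegree_zero_iff_isHomogeneous _).2 (hh k)), MvPolynomial.aeval_C]
    exact ⟨_, rfl⟩
  -- If `q = 0`, coprimality makes `p` a nonzero constant, so `h(p, q)` is a constant vector.
  obtain rfl | hq := eq_or_ne q 0
  · refine JacobianTraceEq.of_polynomial_multiple hg0 hg (jacobianTraceEq_of_constant
      fun k => ?_)
    obtain ⟨u, -, rfl⟩ := MvPolynomial.isUnit_iff_eq_C_of_isReduced.1
      (isRelPrime_zero_right.1 hpq)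
    refine ⟨MvPolynomial.aeval ![u, 0] (h k), ?_⟩
    have h1 : ![MvPolynomial.C u, (0 : MvPolynomial (Fin n) K)] =
        algebraMap K (MvPolynomial (Fin n) K) ∘ ![u, 0] := by
      funext i
      fin_cases i <;> simp [MvPolynomial.algebraMap_eq]
    rw [h1, MvPolynomial.aeval_algebraMap_apply, MvPolynomial.algebraMap_eq]
  have hq' := toRat_ne_zero hq
  have hsK : (s : RatField K n) ≠ 0 := by
    rw [← map_natCast (algebraMap K (RatField K n)), (map_ne_zero _)]
    exact fun h0 => hchar hs ((ringChar.spec K s).1 h0)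
  set f : Fin n → Polynomial K := fun k =>
    MvPolynomial.aeval ![(Polynomial.X : Polynomial K), 1] (h k)
  set θ : RatField K n := toRat p / toRat q with hθ
  set R := fun k => MvPolynomial.aeval ![p, q] (h k) with hR
  have hRf : (fun k => toRat (R k)) = toRat q ^ s • fun k => Polynomial.aeval θ (f k) :=
    funext fun k => (hh k).toRat_aeval p hq
  have hqs : toRat q ^ s ≠ 0 := pow_ne_zero s hq'
  -- When `f'(θ)` is proportional to `f(θ)`, the reformulated trace condition is automatic.
  by_cases hmin : ∀ k l, Polynomial.aeval θ (f k) * Polynomial.aeval θ (derivative (f l)) -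
      Polynomial.aeval θ (derivative (f k)) * Polynomial.aeval θ (f l) = 0
  · refine JacobianTraceEq.of_polynomial_multiple hg0 hg ?_
    rw [hRf, jacobianTraceEq_smul_iff hqs]
    by_cases hφ : (fun k => Polynomial.aeval θ (f k)) = 0
    · rw [hφ]
      exact jacobianTraceEq_zero
    · rw [jacobianTraceEq_aeval_iff]
      obtain ⟨c, hc⟩ := exists_eq_smul_of_minors_eq_zero
        (v := fun k => Polynomial.aeval θ (derivative (f k))) hmin hφ
      intro k
      rw [hc, dirDeriv_smul, congrFun hc k, Pi.smul_apply, smul_eq_mul]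
      ring
  push Not at hmin
  obtain ⟨k, l, hkl⟩ := hmin
  set φ : Fin n → RatField K n := fun k => Polynomial.aeval θ (f k) with hφ
  have hdir : ∀ i, dirDeriv φ (toRat q ^ s) * φ i +
      toRat q ^ s * dirDeriv φ θ * Polynomial.aeval θ (derivative (f i)) = 0 := by
    intro i
    have h1 : dirDeriv (fun k => toRat (R k)) (toRat (R i)) = 0 := by
      rw [dirDeriv_toRat]
      have : ∑ j, pderiv j (R i) * R j = 0 := congrFun hJ i
      rw [this]
      exact map_zero _
    rw [show toRat (R i) = toRat q ^ s * φ i from congrFun hRf i, hRf, dirDeriv_smul,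
      dirDeriv_mul, hφ, dirDeriv_aeval] at h1
    have h2 := (mul_eq_zero.1 h1).resolve_left hqs
    linear_combination h2
  -- Independence makes `q ^ s` and `θ` constant along `φ`. Since `s ≠ 0` in `K`, so is `q`, and
  -- hence `p = θ q`; this is where the condition on the characteristic enters.
  obtain ⟨h1, h2⟩ := eq_zero_of_smul_add_smul_eq_zero (u := φ)
    (v := fun i => Polynomial.aeval θ (derivative (f i))) hkl hdir
  have hθ0 : dirDeriv φ θ = 0 := (mul_eq_zero.1 h2).resolve_left hqs
  have hq0 : dirDeriv φ (toRat q) = 0 := by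
    have h3 := dirDeriv_aeval φ (Polynomial.X ^ s : Polynomial K) (toRat q)
    rw [Polynomial.aeval_X_pow, h1, Polynomial.derivative_X_pow, map_mul, Polynomial.aeval_C,
      Polynomial.aeval_X_pow, map_natCast] at h3
    exact (mul_eq_zero.1 h3.symm).resolve_left (mul_ne_zero hsK (pow_ne_zero _ hq'))
  have hp0 : dirDeriv φ (toRat p) = 0 := by
    have h3 := dirDeriv_mul φ θ (toRat q)
    rw [hθ0, hq0, mul_zero, mul_zero, add_zero, hθ, div_mul_cancel₀ _ hq'] at h3
    exact h3
  refine IsFractionForm.jacobianTraceEq (f := f) (p := p) (q := q)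
    ⟨hq, ⟨g * toRat q ^ s, fun k => ?_⟩,
      gradDot_eq_zero_of_aeval hpq hq (le_max_left _ _) ((aeval_gradDot _ _ _).trans hp0),
      gradDot_eq_zero_of_aeval hpq hq (le_max_right _ _) ((aeval_gradDot _ _ _).trans hq0)⟩
  rw [hg, mul_assoc]
  exact congrArg _ (congrFun hRf k)

end HomogeneousForm

/-! ### Few constant vectors suffice. -/

section Combination

variable {K : Type*} [Field K] {n : ℕ}

/-- The coefficient vectors of `P` are annihilated by the Jacobian matrix of `P`. -/
theorem JacobianSeparatedZero.sum_pderiv_mul_coeff {P : Fin n → MvPolynomial (Fin n) K}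
    (h : JacobianSeparatedZero P) (k : Fin n) (m : Fin n →₀ ℕ) :
    ∑ i, pderiv i (P k) * MvPolynomial.C ((P i).coeff m) = 0 := by
  let ε : MvPolynomial (Fin n ⊕ Fin n) K →ₐ[K] MvPolynomial (Fin n) (MvPolynomial (Fin n) K) :=
    MvPolynomial.aeval (Sum.elim (fun i => MvPolynomial.C (MvPolynomial.X i)) MvPolynomial.X)
  have hl : ∀ u : MvPolynomial (Fin n) K,
      ε (MvPolynomial.rename Sum.inl u) = MvPolynomial.C u := fun u => by
    induction u using MvPolynomial.induction_on with
    | C a =>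
      rw [MvPolynomial.rename_C, ← MvPolynomial.algebraMap_eq, AlgHom.commutes]
      rfl
    | add a b ha hb => simp only [map_add, ha, hb]
    | mul_X a i ha => simp only [map_mul, ha, MvPolynomial.rename_X]; simp [ε]
  have hr : ∀ u : MvPolynomial (Fin n) K,
      ε (MvPolynomial.rename Sum.inr u) = MvPolynomial.map MvPolynomial.C u := fun u => by
    induction u using MvPolynomial.induction_on with
    | C a =>
      rw [MvPolynomial.rename_C, ← MvPolynomial.algebraMap_eq, AlgHom.commutes,
        MvPolynomial.map_C]
      rfl
    | add a b ha hb => simp only [map_add, ha, hb]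
    | mul_X a i ha => simp only [map_mul, ha, MvPolynomial.rename_X, MvPolynomial.map_X]; simp [ε]
  have h1 := congrArg (fun u => MvPolynomial.coeff m (ε u)) (congrFun h.1 k)
  simpa [Matrix.mulVec, dotProduct, polyJacobian, hl, hr, MvPolynomial.coeff_sum,
    MvPolynomial.coeff_C_mul, MvPolynomial.coeff_map] using h1

theorem isCombination_append {R : Type*} [CommRing R] [Algebra K R] {P : Fin n → R} {d e : ℕ}
    {v : Fin d → Fin n → K} (h : IsCombination P v) :
    IsCombination P (Fin.append v (0 : Fin e → Fin n → K)) := by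
  obtain ⟨a, ha⟩ := h
  exact ⟨Fin.append a 0, fun k => by simp [ha, Fin.sum_univ_add]⟩

/-- The `K`-span `V` of the coefficient vectors of `P` is killed by `JP`, and a `K`-basis of `V`
stays independent over `K(x)`; thus `dim V ≤ n - rk JP`, and `P` is a combination of that basis. -/
theorem JacobianSeparatedZero.exists_isCombination {P : Fin n → MvPolynomial (Fin n) K}
    (h : JacobianSeparatedZero P) :
    ∃ v : Fin (n - ((polyJacobian P).map toRat).rank) → Fin n → K, IsCombination P v := by
  let V : Submodule K (Fin n → K) :=
    Submodule.span K (Set.range fun m : Fin n →₀ ℕ => fun k => (P k).coeff m)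
  set d := Module.finrank K V
  let b := Module.finBasis K V
  let B : Matrix (Fin n) (Fin d) K := Matrix.of fun k j => (b j : Fin n → K) k
  have hBrange : ∀ w ∈ V, ∃ c, w = B.mulVec c := by
    intro w hw
    refine ⟨b.repr ⟨w, hw⟩, ?_⟩
    have h1 := congrArg (Subtype.val) (b.sum_repr ⟨w, hw⟩)
    funext k
    have h2 := congrFun h1 k
    simp only [AddSubmonoidClass.coe_finsetSum, Finset.sum_apply, Submodule.coe_smul,
      Pi.smul_apply, smul_eq_mul] at h2
    rw [← h2]
    exact Finset.sum_congr rfl fun j _ => mul_comm _ _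
  have hBinj : LinearMap.ker B.mulVecLin = ⊥ := by
    rw [LinearMap.ker_eq_bot']
    intro c hc
    have hli : LinearIndependent K fun j => (b j : Fin n → K) :=
      b.linearIndependent.map' V.subtype V.ker_subtype
    refine funext (Fintype.linearIndependent_iff.1 hli c ?_)
    rw [← hc]
    funext k
    simp only [Finset.sum_apply, Pi.smul_apply, smul_eq_mul, Matrix.mulVecLin_apply,
      Matrix.mulVec, dotProduct]
    exact Finset.sum_congr rfl fun j _ => mul_comm _ _
  -- The left inverse serves twice: it shows that `B` keeps rank `d` over `K(x)`, and `C P` gives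
  -- the polynomial coefficients of `P` in the basis.
  obtain ⟨C', hC'⟩ := B.mulVecLin.exists_leftInverse_of_injective hBinj
  set C : Matrix (Fin d) (Fin n) K := LinearMap.toMatrix' C' with hC
  have hCB : C * B = 1 := by
    rw [hC, ← LinearMap.toMatrix'_toLin' B, ← LinearMap.toMatrix'_comp, Matrix.toLin'_apply', hC',
      LinearMap.toMatrix'_id]
  have hBC : ∀ w ∈ V, B.mulVec (C.mulVec w) = w := by
    intro w hw
    obtain ⟨c, rfl⟩ := hBrange w hw
    rw [Matrix.mulVec_mulVec (M := C), hCB, Matrix.one_mulVec]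
  set A := (polyJacobian P).map toRat with hA
  have hAV : ∀ w ∈ V, ∀ k, ∑ i, pderiv i (P k) * MvPolynomial.C (w i) = 0 := by
    intro w hw k
    induction hw using Submodule.span_induction with
    | mem x hx =>
      obtain ⟨m, rfl⟩ := hx
      exact h.sum_pderiv_mul_coeff k m
    | zero => simp
    | add x y _ _ hx hy => simp [mul_add, Finset.sum_add_distrib, hx, hy]
    | smul a x _ hx =>
      simp only [Pi.smul_apply, smul_eq_mul, map_mul, mul_left_comm _ (MvPolynomial.C a)]
      rw [← Finset.mul_sum, hx, mul_zero]
  have hAB : A * B.map (algebraMap K (RatField K n)) = 0 := by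
    ext k j
    have h1 := congrArg (toRat (K := K) (n := n)) (hAV (b j) (b j).2 k)
    simp only [map_sum, map_mul, map_zero] at h1
    rw [Matrix.mul_apply, Matrix.zero_apply, ← h1]
    refine Finset.sum_congr rfl fun i _ => ?_
    simp only [hA, polyJacobian, Matrix.map_apply, Matrix.of_apply, B,
      IsScalarTower.algebraMap_apply K (MvPolynomial (Fin n) K) (RatField K n),
      MvPolynomial.algebraMap_eq]
  have hrank : A.rank + d ≤ n := by
    have h1 := Matrix.rank_add_rank_le_card_of_mul_eq_zero hAB
    have h2 : C.map (algebraMap K (RatField K n)) * B.map (algebraMap K (RatField K n)) = 1 := by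
      rw [← Matrix.map_mul, hCB, Matrix.map_one _ (map_zero _) (map_one _)]
    have h3 := Matrix.rank_mul_le_right (C.map (algebraMap K (RatField K n)))
      (B.map (algebraMap K (RatField K n)))
    rw [h2, Matrix.rank_one, Fintype.card_fin] at h3
    rw [Fintype.card_fin] at h1
    omega
  have hcomb : IsCombination P fun j => (b j : Fin n → K) := by
    refine ⟨fun j => ∑ i, MvPolynomial.C (C j i) * P i, fun k => ?_⟩
    ext m
    have h1 : B.mulVec (C.mulVec fun k => (P k).coeff m) k = (P k).coeff m :=
      congrFun (hBC _ (Submodule.subset_span ⟨m, rfl⟩)) k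
    rw [← h1]
    simp only [MvPolynomial.coeff_sum, MvPolynomial.algebraMap_eq]
    change ∑ j, B k j * ∑ i, C j i * (P i).coeff m = _
    refine Finset.sum_congr rfl fun j _ => ?_
    rw [mul_comm _ (MvPolynomial.C _), MvPolynomial.coeff_C_mul, MvPolynomial.coeff_sum]
    simp only [MvPolynomial.coeff_C_mul]
    rfl
  -- The dimension of `V` may be smaller than `n - rk JP`, so the basis is padded with zero vectors.
  obtain ⟨e, he⟩ := Nat.exists_eq_add_of_le (show d ≤ n - A.rank by omega)
  rw [he]
  exact ⟨_, isCombination_append hcomb⟩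

theorem IsCombination.mul {R S : Type*} [CommRing R] [Algebra K R] [CommRing S] [Algebra K S]
    {P : Fin n → R} {r : ℕ} {v : Fin r → Fin n → K} (h : IsCombination P v) (σ : R →ₐ[K] S)
    {Q : Fin n → S} (c : S) (hQ : ∀ k, Q k = c * σ (P k)) : IsCombination Q v := by
  obtain ⟨a, ha⟩ := h
  refine ⟨fun j => c * σ (a j), fun k => ?_⟩
  rw [hQ, ha, map_sum, Finset.mul_sum]
  exact Finset.sum_congr rfl fun j _ => by rw [map_mul, AlgHom.commutes, mul_assoc]

/-- Everything is scaled by `c` in `H = c P`; when `H` is polynomial, primitivity of `P` makes `c` a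
polynomial. -/
theorem IsPrimitivePart.isCombination {H : Fin n → RatField K n}
    {P : Fin n → MvPolynomial (Fin n) K} (hP : IsPrimitivePart H P) {r : ℕ}
    {v : Fin r → Fin n → K} (h : IsCombination P v) :
    IsCombination H v ∧
      ∀ Q : Fin n → MvPolynomial (Fin n) K, (∀ k, H k = toRat (Q k)) → IsCombination Q v := by
  obtain rfl | hH := eq_or_ne H 0
  · refine ⟨⟨0, by simp⟩, fun Q hQ => ⟨0, fun k => ?_⟩⟩
    simpa using toRat_injective ((hQ k).symm.trans (map_zero _).symm)
  obtain ⟨hprim, c, -, hc⟩ := hP.eq_mul hH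
  refine ⟨h.mul (IsScalarTower.toAlgHom K _ _) c hc, fun Q hQ => ?_⟩
  obtain ⟨d, rfl⟩ := hprim.exists_eq_toRat (c := c) (Q := Q) fun k => by rw [← hQ, hc]
  refine h.mul (AlgHom.id K _) d fun k => toRat_injective ?_
  rw [← hQ, hc]
  simp only [map_mul, AlgHom.id_apply]

end Combination

end

theorem mainTheorem2 {K : Type*} [Field K] {n : ℕ} (hn : 1 ≤ n)
    (H : Fin n → RatField K n) (htr : trdegScaled H ≤ 2)
    (P : Fin n → MvPolynomial (Fin n) K) (hP : IsPrimitivePart H P) :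
    List.TFAE
      [JacobianTraceEq H,
       JacobianSeparatedZero P,
       HomogeneousForm H,
       ∃ (f : Fin n → Polynomial K) (p q : MvPolynomial (Fin n) K), IsFractionForm H f p q,
       ∃ (f : Fin n → Polynomial K) (p q : MvPolynomial (Fin n) K),
         IsFractionForm H f p q ∧ IsPrimitiveTuple f ∧ IsRelPrime p q] ∧
    ((JacobianTraceEq H ∨ JacobianSeparatedZero P ∨ HomogeneousForm H ∨
      (∃ (f : Fin n → Polynomial K) (p q : MvPolynomial (Fin n) K), IsFractionForm H f p q) ∨
      (∃ (f : Fin n → Polynomial K) (p q : MvPolynomial (Fin n) K),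
         IsFractionForm H f p q ∧ IsPrimitiveTuple f ∧ IsRelPrime p q)) →
      ∃ v : Fin (n - ((polyJacobian P).map toRat).rank) → Fin n → K,
        IsCombination P v ∧ IsCombination H v ∧
        ∀ Q : Fin n → MvPolynomial (Fin n) K, (∀ k, H k = toRat (Q k)) → IsCombination Q v) := by
  have htfae : List.TFAE
      [JacobianTraceEq H,
       JacobianSeparatedZero P,
       HomogeneousForm H,
       ∃ (f : Fin n → Polynomial K) (p q : MvPolynomial (Fin n) K), IsFractionForm H f p q,
       ∃ (f : Fin n → Polynomial K) (p q : MvPolynomial (Fin n) K),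
         IsFractionForm H f p q ∧ IsPrimitiveTuple f ∧ IsRelPrime p q] := by
    tfae_have 1 → 5 := fun h => h.exists_isFractionForm hn htr
    tfae_have 5 → 4 := fun ⟨f, p, q, h, _⟩ => ⟨f, p, q, h⟩
    tfae_have 4 → 1 := fun ⟨_, _, _, h⟩ => h.jacobianTraceEq
    tfae_have 5 → 2 := fun ⟨_, _, _, h, _⟩ => h.jacobianSeparatedZero hP
    tfae_have 2 → 1 := fun h => h.jacobianTraceEq hP
    tfae_have 5 → 3 := fun ⟨_, _, _, h, _, hpq⟩ => h.homogeneousForm hpq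
    tfae_have 3 → 1 := fun h => h.jacobianTraceEq
    tfae_finish
  refine ⟨htfae, fun h => ?_⟩
  have h2 : JacobianSeparatedZero P := by
    rcases h with h | h | h | h | h
    · exact (htfae.out 0 1).1 h
    · exact h
    · exact (htfae.out 2 1).1 h
    · exact (htfae.out 3 1).1 h
    · exact (htfae.out 4 1).1 h
  obtain ⟨v, hv⟩ := h2.exists_isCombination
  exact ⟨v, hv, hP.isCombination hv⟩
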